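/- All graphs are finite, simple and undirected; $P_n$ is the path on $n$ vertices. Fix $n\ge 4$. For a graph $G$, let $HL(G)$ be the $P_n$-line graph of $G$: its vertices are the edges of $G$, and two distinct edges of $G$ are adjacent in $HL(G)$ if they share an endpoint and lie in a common subgraph of $G$ isomorphic to $P_n$. Put $HL^0(G)=G$ and $HL^{k+1}(G)=HL(HL^k(G))$. The sequence $\{HL^k(G)\}_{k\ge 0}$ terminates if some $HL^k(G)$ is empty (has no edges), and it converges if it does not terminate and $HL^N(G)\cong HL^{N+1}(G)$ for some $N\ge 0$. A graph $G$ is minimally $n$-convergent if its sequence converges but the sequence of no proper subgraph of $G$ converges. A graph is unicyclic if it is connected and contains exactly one cycle. The girth $g$ of a graph is the length of a shortest cycle ($\infty$ if there is none). **Theorem.** Let $G$ be a minimally $n$-convergent graph such that $g(HL(G))>4$. If every connected component of $G$ is unicyclic, then every connected component of $HL(G)$ is unicyclic. -/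

import Mathlib

universe u v

/-- The `H`-line graph of `G`: its vertices are the edges of `G`, and two of them are adjacent iff
they are distinct edges of `G` with a common endpoint that lie in a common subgraph of `G`
isomorphic to `H`. -/
def HLineGraph {V W : Type*} (H : SimpleGraph W) (G : SimpleGraph V) :
    SimpleGraph G.edgeSet where
  Adj e f := G.lineGraph.Adj e f ∧
    ∃ S : G.Subgraph, Nonempty (H ≃g S.coe) ∧ (e : Sym2 V) ∈ S.edgeSet ∧ (f : Sym2 V) ∈ S.edgeSet
  symm := ⟨fun _ _ h => ⟨h.1.symm, h.2.imp fun _ hS => ⟨hS.1, hS.2.2, hS.2.1⟩⟩⟩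
  loopless := ⟨fun e h => G.lineGraph.loopless.irrefl e h.1⟩

/-- The iterated `H`-line graphs `HL^k(G)`, each bundled with its vertex type:
`HL^0(G) = G` and `HL^(k+1)(G) = HL(HL^k(G))`. -/
def iterHLineGraph {V : Type u} {W : Type v} (H : SimpleGraph W) (G : SimpleGraph V) :
    ℕ → (U : Type u) × SimpleGraph U
  | 0 => ⟨V, G⟩
  | k + 1 => ⟨(iterHLineGraph H G k).2.edgeSet, HLineGraph H (iterHLineGraph H G k).2⟩

/-- The sequence `HL^k(G)` terminates: it reaches an empty (that is, edgeless) graph. -/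
def HLTerminates {V W : Type*} (H : SimpleGraph W) (G : SimpleGraph V) : Prop :=
  ∃ k, (iterHLineGraph H G k).2 = ⊥

/-- The sequence `HL^k(G)` converges: it does not terminate, and two consecutive terms are
isomorphic. -/
def HLConverges {V W : Type*} (H : SimpleGraph W) (G : SimpleGraph V) : Prop :=
  ¬ HLTerminates H G ∧
    ∃ N, Nonempty ((iterHLineGraph H G N).2 ≃g (iterHLineGraph H G (N + 1)).2)

/-- `G` is minimally `n`-convergent: its sequence of iterated `P_n`-line graphs converges, where
`P_n` is the path with `n` vertices, but that of no proper subgraph of `G` does. -/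
def IsMinimallyConvergent {V : Type*} (n : ℕ) (G : SimpleGraph V) : Prop :=
  HLConverges (SimpleGraph.pathGraph n) G ∧
    ∀ S : G.Subgraph, S ≠ ⊤ → ¬ HLConverges (SimpleGraph.pathGraph n) S.coe

/-- A unicyclic graph: connected, with exactly one cycle (as a subgraph). -/
def IsUnicyclic {V : Type*} (G : SimpleGraph V) : Prop :=
  G.Connected ∧ ∃! C : G.Subgraph, ∃ (v : V) (p : G.Walk v v), p.IsCycle ∧ p.toSubgraph = C

/-! The proof counts edges. The vertices of HL(G) are the edges of G, and |E(G)| = |V(G)| because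
the components of G are unicyclic. If HL(G) has at most as many edges as vertices and no component
of it is a tree, then each component has exactly as many edges as vertices, and a connected graph of
this kind is unicyclic.

Upper bound (`card_edgeSet_hLineGraph_le`). Sort the edges of HL(G) by the vertex v shared by the
two edges of G; at v they form a graph T_v on the neighbours of v. Two neighbours are adjacent in
T_v exactly when the longest paths from them avoiding v have at least n - 1 vertices in total,
except for at most one pair, the neighbours of v on a cycle. Without triangles and four-cycles, such
a near-threshold graph has at most deg v - 1 edges (`card_edgeSet_lt_of_threshold`), and these
bounds add up to 2|E(G)| - |V(G)| = |E(G)|.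

No tree components (`IsMinimallyConvergent.not_isAcyclic`). The edges of a path with at least n
vertices lie in one component of HL(G), so deleting from G the edges that form a component c removes
just c from HL(G). If c is a tree, its sequence terminates or is unbounded. The latter contradicts
convergence of G; the former makes a proper subgraph convergent.

Dichotomy for forests (`terminates_or_isUnbounded`). While HL of a forest is again a forest, the
edge count drops. A cycle in it forces three legs at one vertex, any two of which form a long path.
They turn into a cycle with three tails; iterating feeds the tails into the cycle until it has at
least n vertices and a pendant edge, and from there paths grow at every step. -/

open SimpleGraph

/-! ### Edge lists of vertex lists -/

section Lists
variable {V : Type*}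

/-- The list of edges joining consecutive entries of a list of vertices. -/
def linkEdges : List V → List (Sym2 V)
  | a :: b :: l => s(a, b) :: linkEdges (b :: l)
  | _ => []

@[simp] lemma linkEdges_nil : linkEdges ([] : List V) = [] := rfl
@[simp] lemma linkEdges_singleton (a : V) : linkEdges [a] = [] := rfl
@[simp] lemma linkEdges_cons_cons (a b : V) (l : List V) :
    linkEdges (a :: b :: l) = s(a, b) :: linkEdges (b :: l) := rfl

@[simp] lemma length_linkEdges : ∀ l : List V, (linkEdges l).length = l.length - 1
  | [] => rfl
  | [_] => rfl
  | a :: b :: l => by simp [length_linkEdges (b :: l)]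

lemma linkEdges_append (l₁ : List V) (a : V) (l₂ : List V) :
    linkEdges (l₁ ++ a :: l₂) = linkEdges (l₁ ++ [a]) ++ linkEdges (a :: l₂) := by
  induction l₁ with
  | nil => simp
  | cons x l ih => cases l <;> simp_all

lemma linkEdges_map {W : Type*} (f : V → W) :
    ∀ l : List V, linkEdges (l.map f) = (linkEdges l).map (Sym2.map f)
  | [] => rfl
  | [_] => rfl
  | a :: b :: l => by
    have := linkEdges_map f (b :: l)
    simp_all

lemma mem_linkEdges_iff {l : List V} {e : Sym2 V} :
    e ∈ linkEdges l ↔ ∃ l₁ a b l₂, l = l₁ ++ a :: b :: l₂ ∧ e = s(a, b) := by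
  constructor
  · induction l with
    | nil => simp
    | cons x l ih =>
      cases l with
      | nil => simp
      | cons y l =>
        simp only [linkEdges_cons_cons, List.mem_cons]
        rintro (rfl | h)
        · exact ⟨[], x, y, l, rfl, rfl⟩
        · obtain ⟨l₁, a, b, l₂, hl, he⟩ := ih h
          exact ⟨x :: l₁, a, b, l₂, by rw [hl]; rfl, he⟩
  · rintro ⟨l₁, a, b, l₂, rfl, rfl⟩
    rw [linkEdges_append]; simp

lemma mem_of_mem_linkEdges {l : List V} {e : Sym2 V} (h : e ∈ linkEdges l) {x : V} (hx : x ∈ e) :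
    x ∈ l := by
  obtain ⟨l₁, a, b, l₂, rfl, rfl⟩ := mem_linkEdges_iff.1 h
  rcases Sym2.mem_iff.1 hx with rfl | rfl <;> simp

lemma linkEdges_nodup {l : List V} (h : l.Nodup) : (linkEdges l).Nodup := by
  induction l with
  | nil => simp
  | cons x l ih =>
    cases l with
    | nil => simp
    | cons y l =>
      rw [List.nodup_cons] at h
      refine List.nodup_cons.2 ⟨fun hm => h.1 (mem_of_mem_linkEdges hm (by simp)), ih h.2⟩

lemma isChain_iff_linkEdges {G : SimpleGraph V} {l : List V} :
    l.IsChain G.Adj ↔ ∀ e ∈ linkEdges l, e ∈ G.edgeSet := by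
  induction l with
  | nil => simp
  | cons x l ih => cases l <;> simp_all

/-- Consecutive edges of the list come from three consecutive vertices, so gluing arguments for edge
lists reduce to vertex triples. -/
lemma isChain_linkEdges_iff {R : Sym2 V → Sym2 V → Prop} {l : List V} :
    (linkEdges l).IsChain R ↔
      ∀ l₁ a b c l₂, l = l₁ ++ a :: b :: c :: l₂ → R s(a, b) s(b, c) := by
  constructor
  · rintro h l₁ a b c l₂ rfl
    rw [linkEdges_append] at h
    have := h.right_of_append
    simp at this
    exact this.1
  · induction l with
    | nil => simp
    | cons x l ih =>
      match l with
      | [] => simp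
      | [y] => simp
      | y :: z :: l =>
        intro h
        simp only [linkEdges_cons_cons, List.isChain_cons_cons] at ih ⊢
        refine ⟨h [] x y z l rfl, ih fun l₁ a b c l₂ e => h (x :: l₁) a b c l₂ (by simp [e])⟩

end Lists

/-! ### Path adjacency and the P_n-line graph -/

section PathAdj
variable {V : Type*}

/-- Two edges are `n`-path adjacent if they are consecutive on a path with at least `n` vertices. -/
def PathAdj (n : ℕ) (G : SimpleGraph V) (e f : Sym2 V) : Prop :=
  ∃ l₁ a b c l₂, (l₁ ++ a :: b :: c :: l₂).IsChain G.Adj ∧ (l₁ ++ a :: b :: c :: l₂).Nodup ∧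
    n ≤ (l₁ ++ a :: b :: c :: l₂).length ∧ e = s(a, b) ∧ f = s(b, c)

lemma PathAdj.symm {n : ℕ} {G : SimpleGraph V} {e f : Sym2 V} (h : PathAdj n G e f) :
    PathAdj n G f e := by
  obtain ⟨l₁, a, b, c, l₂, h₁, h₂, h₃, rfl, rfl⟩ := h
  have e : l₂.reverse ++ c :: b :: a :: l₁.reverse = (l₁ ++ a :: b :: c :: l₂).reverse := by simp
  refine ⟨l₂.reverse, c, b, a, l₁.reverse, ?_, ?_, ?_, Sym2.eq_swap, Sym2.eq_swap⟩
  · rw [e, List.isChain_reverse]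
    exact h₁.imp fun _ _ h => h.symm
  · rw [e, List.nodup_reverse]; exact h₂
  · rw [e, List.length_reverse]; exact h₃

lemma PathAdj.ne {n : ℕ} {G : SimpleGraph V} {e f : Sym2 V} (h : PathAdj n G e f) : e ≠ f := by
  obtain ⟨l₁, a, b, c, l₂, -, h₂, -, rfl, rfl⟩ := h
  simp only [List.nodup_append, List.nodup_cons] at h₂
  intro h
  simp_all

lemma PathAdj.left_mem {n : ℕ} {G : SimpleGraph V} {e f : Sym2 V} (h : PathAdj n G e f) :
    e ∈ G.edgeSet := by
  obtain ⟨l₁, a, b, c, l₂, h₁, -, -, rfl, rfl⟩ := h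
  have := h₁.right_of_append
  simp_all

lemma PathAdj.right_mem {n : ℕ} {G : SimpleGraph V} {e f : Sym2 V} (h : PathAdj n G e f) :
    f ∈ G.edgeSet := h.symm.left_mem

/-- The `P_n`-line graph, carried by all unordered pairs of vertices: the pairs that are not edges
are isolated. -/
def pathLine (n : ℕ) (G : SimpleGraph V) : SimpleGraph (Sym2 V) where
  Adj := PathAdj n G
  symm := ⟨fun _ _ h => h.symm⟩
  loopless := ⟨fun _ h => h.ne rfl⟩

/-- The edges of a path with at least `n` vertices form a path of the `P_n`-line graph. -/
lemma isChain_pathLine {n : ℕ} {G : SimpleGraph V} {l : List V} (h₁ : l.IsChain G.Adj)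
    (h₂ : l.Nodup) (h₃ : n ≤ l.length) : (linkEdges l).IsChain (pathLine n G).Adj := by
  rw [isChain_linkEdges_iff]
  rintro l₁ a b c l₂ rfl
  exact ⟨l₁, a, b, c, l₂, h₁, h₂, h₃, rfl, rfl⟩

lemma exists_subgraph_of_list {n : ℕ} {G : SimpleGraph V} {l : List V} (h₁ : l.IsChain G.Adj)
    (h₂ : l.Nodup) (h₃ : l.length = n) :
    ∃ S : G.Subgraph, Nonempty (pathGraph n ≃g S.coe) ∧ ∀ e ∈ linkEdges l, e ∈ S.edgeSet := by
  subst h₃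
  rw [List.isChain_iff_getElem] at h₁
  let φ : Copy (pathGraph l.length) G :=
    ⟨⟨fun i => l[i], by
      intro i j hij
      rw [pathGraph_adj] at hij
      rcases hij with h | h
      · have := h₁ i.1 (by omega)
        simpa [h] using this
      · have := h₁ j.1 (by omega)
        simpa [h] using this.symm⟩, by
      intro i j hij
      exact Fin.ext ((List.Nodup.getElem_inj_iff h₂).1 hij)⟩
  refine ⟨φ.toSubgraph, ⟨φ.isoToSubgraph⟩, ?_⟩
  intro e he
  obtain ⟨m₁, a, b, m₂, hl, rfl⟩ := mem_linkEdges_iff.1 he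
  rw [Subgraph.mem_edgeSet, Subgraph.map_adj]
  have hlen : m₁.length + 1 < l.length := by simp [hl]
  refine ⟨⟨m₁.length, by omega⟩, ⟨m₁.length + 1, hlen⟩, ?_, ?_, ?_⟩
  · simp [pathGraph_adj]
  · change l[m₁.length] = a
    simp [hl]
  · change l[m₁.length + 1] = b
    simp [hl]

lemma exists_list_of_subgraph {n : ℕ} {G : SimpleGraph V} {S : G.Subgraph}
    (φ : pathGraph n ≃g S.coe) :
    ∃ l : List V, l.IsChain G.Adj ∧ l.Nodup ∧ l.length = n ∧ ∀ e ∈ S.edgeSet, e ∈ linkEdges l := by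
  refine ⟨List.ofFn fun i => (φ i).1, ?_, ?_, by simp, ?_⟩
  · rw [List.isChain_iff_getElem]
    intro i hi
    simp only [List.length_ofFn] at hi
    have : (pathGraph n).Adj ⟨i, by omega⟩ ⟨i + 1, hi⟩ := by simp [pathGraph_adj]
    simpa using S.adj_sub (φ.map_rel_iff.2 this)
  · rw [List.nodup_ofFn]
    exact Subtype.val_injective.comp φ.injective
  · have key : ∀ i j : Fin n, i.1 + 1 = j.1 →
        s((φ i).1, (φ j).1) ∈ linkEdges (List.ofFn fun i => (φ i).1) := by
      intro i j hij
      set l := List.ofFn fun i => (φ i).1 with hl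
      have hlen : l.length = n := by simp [hl]
      rw [mem_linkEdges_iff]
      refine ⟨l.take i, l[i.1], l[j.1], l.drop (j + 1), ?_, by simp [hl]⟩
      rw [← List.drop_eq_getElem_cons]
      simp only [← hij]
      rw [← List.drop_eq_getElem_cons, List.take_append_drop]
    intro e he
    induction e with | _ x y =>
    rw [Subgraph.mem_edgeSet] at he
    obtain ⟨i, hi⟩ := φ.surjective ⟨x, S.edge_vert he⟩
    obtain ⟨j, hj⟩ := φ.surjective ⟨y, S.edge_vert he.symm⟩
    have hx : x = (φ i).1 := by rw [hi]
    have hy : y = (φ j).1 := by rw [hj]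
    have : (pathGraph n).Adj i j := by
      rw [← φ.map_rel_iff, hi, hj]; exact he
    rw [pathGraph_adj] at this
    subst hx hy
    rcases this with h | h
    · exact key i j h
    · rw [Sym2.eq_swap]; exact key j i h

/-- Two distinct edges of a path with a common end are consecutive. -/
lemma consecutive_of_mem_linkEdges {l : List V} (h : l.Nodup) {e f : Sym2 V}
    (he : e ∈ linkEdges l) (hf : f ∈ linkEdges l) (hne : e ≠ f) {x : V} (hxe : x ∈ e)
    (hxf : x ∈ f) :
    ∃ l₁ a b c l₂, l = l₁ ++ a :: b :: c :: l₂ ∧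
      ((e = s(a, b) ∧ f = s(b, c)) ∨ (f = s(a, b) ∧ e = s(b, c))) := by
  induction l with
  | nil => simp at he
  | cons y l ih =>
    match l with
    | [] => simp at he
    | [z] => simp_all
    | z :: w :: l =>
      have hh := h
      rw [List.nodup_cons] at h
      rw [linkEdges_cons_cons, List.mem_cons] at he hf
      have aux : ∀ {g : Sym2 V}, x ∈ s(y, z) → x ∈ g → g ∈ linkEdges (z :: w :: l) →
          g = s(z, w) := by
        intro g hx hxg hg
        have hxl := mem_of_mem_linkEdges hg hxg
        rcases Sym2.mem_iff.1 hx with rfl | rfl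
        · exact absurd hxl h.1
        · rw [linkEdges_cons_cons, List.mem_cons] at hg
          rcases hg with h' | h'
          · exact h'
          · exact absurd (mem_of_mem_linkEdges h' hxg) (List.nodup_cons.1 h.2).1
      rcases he with rfl | he <;> rcases hf with rfl | hf
      · exact absurd rfl hne
      · exact ⟨[], y, z, w, l, rfl, Or.inl ⟨rfl, aux hxe hxf hf⟩⟩
      · exact ⟨[], y, z, w, l, rfl, Or.inr ⟨rfl, aux hxf hxe he⟩⟩
      · obtain ⟨l₁, a, b, c, l₂, h1, h2⟩ := ih h.2 he hf
        exact ⟨y :: l₁, a, b, c, l₂, by simp [h1], h2⟩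

/-- A path with more than n vertices can be trimmed at its ends to n vertices while keeping the
three vertices of the two edges; this needs n ≥ 3. -/
lemma hLineGraph_adj_iff {n : ℕ} (hn : 3 ≤ n) {G : SimpleGraph V} {e f : G.edgeSet} :
    (HLineGraph (pathGraph n) G).Adj e f ↔ PathAdj n G e f := by
  constructor
  · rintro ⟨⟨hne, x, hx⟩, S, ⟨φ⟩, he, hf⟩
    obtain ⟨l, h₁, h₂, h₃, h₄⟩ := exists_list_of_subgraph φ
    obtain ⟨l₁, a, b, c, l₂, rfl, h | h⟩ := consecutive_of_mem_linkEdges h₂ (h₄ _ he) (h₄ _ hf)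
      (fun h => hne (Subtype.ext h)) hx.1 hx.2
    · exact ⟨l₁, a, b, c, l₂, h₁, h₂, h₃.ge, h.1, h.2⟩
    · exact PathAdj.symm ⟨l₁, a, b, c, l₂, h₁, h₂, h₃.ge, h.1, h.2⟩
  · intro h
    have hne := h.ne
    obtain ⟨l₁, a, b, c, l₂, h₁, h₂, h₃, he, hf⟩ := h
    refine ⟨⟨fun h => hne (by rw [h]), b, by simp [he], by simp [hf]⟩, ?_⟩
    -- Keep m vertices after c, as many as possible up to n - 3, and the remaining k before a.
    obtain ⟨k, m, hk, hm, hkm⟩ : ∃ k m, k ≤ l₁.length ∧ m ≤ l₂.length ∧ k + m + 3 = n := by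
      simp at h₃
      refine ⟨n - 3 - min l₂.length (n - 3), min l₂.length (n - 3), ?_, ?_, ?_⟩ <;> omega
    have hinf : (l₁.drop (l₁.length - k) ++ a :: b :: c :: l₂.take m) <:+:
        (l₁ ++ a :: b :: c :: l₂) :=
      ⟨l₁.take (l₁.length - k), l₂.drop m, by
        rw [← List.append_assoc, List.take_append_drop]; simp⟩
    obtain ⟨S, hS, hS'⟩ := exists_subgraph_of_list (n := n) (h₁.infix hinf) (hinf.sublist.nodup h₂)
      (by simp; omega)
    refine ⟨S, hS, hS' _ ?_, hS' _ ?_⟩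
    · rw [linkEdges_append]; simp [he]
    · rw [linkEdges_append]; simp [hf]

end PathAdj

/-! ### Unions of connected components -/

section Closed
variable {A B X Y : Type*}

/-- The range of the embedding is a union of connected components. -/
def IsClosedEmbedding {G : SimpleGraph A} {H : SimpleGraph X} (φ : G ↪g H) : Prop :=
  ∀ x y, H.Adj (φ x) y → y ∈ Set.range φ

/-- A property invariant under adjacency is constant along a walk given as a list. -/
lemma List.IsChain.forall_mem_of_exists {V : Type*} {G : SimpleGraph V} {P : V → Prop}
    (hP : ∀ x y, G.Adj x y → P x → P y) {l : List V} (h : l.IsChain G.Adj) {x : V} (hx : x ∈ l)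
    (hPx : P x) : ∀ y ∈ l, P y := by
  have key : l.IsChain fun x y => (P x ↔ P y) :=
    h.imp fun x y hxy => ⟨hP x y hxy, hP y x hxy.symm⟩
  have : IsTrans V fun x y => (P x ↔ P y) := ⟨fun _ _ _ => Iff.trans⟩
  rw [List.isChain_iff_pairwise] at key
  have hs : Std.Symm fun x y => (P x ↔ P y) := ⟨fun _ _ h => h.symm⟩
  intro y hy
  by_cases hxy : x = y
  · exact hxy ▸ hPx
  · exact (key.forall hx hy hxy).1 hPx

lemma exists_map_eq_of_closed {G : SimpleGraph A} {H : SimpleGraph X} {φ : G ↪g H}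
    (hφ : IsClosedEmbedding φ) {l : List X} (h : l.IsChain H.Adj) {x : X} (hx : x ∈ l)
    (hxr : x ∈ Set.range φ) : ∃ l' : List A, l'.map φ = l ∧ l'.IsChain G.Adj := by
  have : ∀ y ∈ l, y ∈ Set.range φ :=
    h.forall_mem_of_exists (fun x y hxy ⟨a, ha⟩ => hφ a y (ha ▸ hxy)) hx hxr
  obtain ⟨l', rfl⟩ : l ∈ Set.range (List.map φ) := by rwa [Set.range_list_map]
  refine ⟨l', rfl, ?_⟩
  rw [List.isChain_map] at h
  simpa using h

/-- A path is connected, so one that meets a union of components stays inside it and pulls back. -/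
lemma pathAdj_map_iff {G : SimpleGraph A} {H : SimpleGraph X} {φ : G ↪g H}
    (hφ : IsClosedEmbedding φ) {n : ℕ} {e f : Sym2 A} :
    PathAdj n H (e.map φ) (f.map φ) ↔ PathAdj n G e f := by
  constructor
  · rintro ⟨l₁, a, b, c, l₂, h₁, h₂, h₃, he, hf⟩
    have hr : a ∈ Set.range φ := by
      have : a ∈ e.map φ := by simp [he]
      obtain ⟨x, -, hx⟩ := Sym2.mem_map.1 this
      exact ⟨x, hx⟩
    obtain ⟨l, hl, hc⟩ := exists_map_eq_of_closed hφ h₁ (x := a) (by simp) hr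
    obtain ⟨m₁, m', rfl, rfl, hm₁⟩ := List.map_eq_append_iff.1 hl
    obtain ⟨a', m', rfl, rfl, hm₂⟩ := List.map_eq_cons_iff.1 hm₁
    obtain ⟨b', m', rfl, rfl, hm₃⟩ := List.map_eq_cons_iff.1 hm₂
    obtain ⟨c', m, rfl, rfl, rfl⟩ := List.map_eq_cons_iff.1 hm₃
    rw [← hl] at h₂ h₃
    refine ⟨m₁, a', b', c', m, hc, h₂.of_map φ, by simpa using h₃, ?_, ?_⟩
    · exact Sym2.map.injective φ.injective (by simpa using he)
    · exact Sym2.map.injective φ.injective (by simpa using hf)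
  · rintro ⟨l₁, a, b, c, l₂, h₁, h₂, h₃, rfl, rfl⟩
    have e : l₁.map φ ++ φ a :: φ b :: φ c :: l₂.map φ = (l₁ ++ a :: b :: c :: l₂).map φ := by simp
    refine ⟨l₁.map φ, φ a, φ b, φ c, l₂.map φ, ?_, ?_, ?_, by simp, by simp⟩
    · rw [e, List.isChain_map]; simpa using h₁
    · rw [e]; exact h₂.map φ.injective
    · rw [e]; simpa using h₃

/-- Path adjacency propagates membership in the range of a closed embedding. -/
lemma PathAdj.mem_range {G : SimpleGraph A} {H : SimpleGraph X} {φ : G ↪g H}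
    (hφ : IsClosedEmbedding φ) {n : ℕ} {e : Sym2 A} {f : Sym2 X}
    (h : PathAdj n H (e.map φ) f) : ∃ f' ∈ G.edgeSet, f'.map φ = f := by
  obtain ⟨l₁, a, b, c, l₂, h₁, -, -, he, rfl⟩ := h
  have hr : b ∈ Set.range φ := by
    have : b ∈ e.map φ := by simp [he]
    obtain ⟨x, -, hx⟩ := Sym2.mem_map.1 this
    exact ⟨x, hx⟩
  have hbc : H.Adj b c := by
    have := h₁.right_of_append
    simp_all
  obtain ⟨b, rfl⟩ := hr
  obtain ⟨c, rfl⟩ := hφ b c hbc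
  exact ⟨s(b, c), by simpa using hbc, by simp⟩

/-- The embedding of `P_n`-line graphs induced by a closed embedding. -/
def hLineEmbedding {n : ℕ} (hn : 3 ≤ n) {G : SimpleGraph A} {H : SimpleGraph X} (φ : G ↪g H)
    (hφ : IsClosedEmbedding φ) : HLineGraph (pathGraph n) G ↪g HLineGraph (pathGraph n) H where
  toFun e := ⟨e.1.map φ, by
    obtain ⟨e, he⟩ := e
    induction e with | _ x y => simpa using he⟩
  inj' e f h := Subtype.ext (Sym2.map.injective φ.injective (congrArg Subtype.val h))
  map_rel_iff' := by
    intro e f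
    rw [hLineGraph_adj_iff hn, hLineGraph_adj_iff hn]
    exact pathAdj_map_iff hφ

lemma isClosedEmbedding_hLineEmbedding {n : ℕ} (hn : 3 ≤ n) {G : SimpleGraph A}
    {H : SimpleGraph X} (φ : G ↪g H) (hφ : IsClosedEmbedding φ) :
    IsClosedEmbedding (hLineEmbedding hn φ hφ) := by
  intro e f h
  rw [hLineGraph_adj_iff hn] at h
  obtain ⟨f', hf', h'⟩ := PathAdj.mem_range hφ h
  exact ⟨⟨f', hf'⟩, Subtype.ext h'⟩

/-- `X` is the union of images of `A` and `B` under closed embeddings. -/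
def Splits (G : SimpleGraph A) (H : SimpleGraph B) (K : SimpleGraph X) : Prop :=
  ∃ (φ : G ↪g K) (ψ : H ↪g K), IsClosedEmbedding φ ∧ IsClosedEmbedding ψ ∧
    ∀ x, x ∈ Set.range φ ∨ x ∈ Set.range ψ

lemma exists_edge_map_eq {G : SimpleGraph A} {H : SimpleGraph X} {φ : G ↪g H}
    (hφ : IsClosedEmbedding φ) {x y : X} (hx : x ∈ Set.range φ) (h : H.Adj x y) :
    ∃ e ∈ G.edgeSet, e.map φ = s(x, y) := by
  obtain ⟨a, rfl⟩ := hx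
  obtain ⟨b, rfl⟩ := hφ a y h
  exact ⟨s(a, b), by simpa using h, by simp⟩

lemma Splits.hLineGraph {n : ℕ} (hn : 3 ≤ n) {G : SimpleGraph A} {H : SimpleGraph B}
    {K : SimpleGraph X} (h : Splits G H K) :
    Splits (HLineGraph (pathGraph n) G) (HLineGraph (pathGraph n) H)
      (HLineGraph (pathGraph n) K) := by
  obtain ⟨φ, ψ, hφ, hψ, h⟩ := h
  refine ⟨hLineEmbedding hn φ hφ, hLineEmbedding hn ψ hψ,
    isClosedEmbedding_hLineEmbedding hn φ hφ, isClosedEmbedding_hLineEmbedding hn ψ hψ, ?_⟩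
  rintro ⟨e, he⟩
  induction e with | _ x y =>
  rcases h x with hx | hx
  · obtain ⟨e, he, h'⟩ := exists_edge_map_eq hφ hx he
    exact Or.inl ⟨⟨e, he⟩, Subtype.ext h'⟩
  · obtain ⟨e, he, h'⟩ := exists_edge_map_eq hψ hx he
    exact Or.inr ⟨⟨e, he⟩, Subtype.ext h'⟩

lemma Splits.iter {A B X : Type u} {n : ℕ} (hn : 3 ≤ n) {G : SimpleGraph A} {H : SimpleGraph B}
    {K : SimpleGraph X} (h : Splits G H K) : ∀ k, Splits (iterHLineGraph (pathGraph n) G k).2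
      (iterHLineGraph (pathGraph n) H k).2 (iterHLineGraph (pathGraph n) K k).2
  | 0 => h
  | k + 1 => (Splits.iter hn h k).hLineGraph hn

/-- If the first part has no vertices, the second part is everything. -/
lemma Splits.nonempty_iso {G : SimpleGraph A} {H : SimpleGraph B} {K : SimpleGraph X}
    (h : Splits G H K) (hA : IsEmpty A) : Nonempty (H ≃g K) := by
  obtain ⟨φ, ψ, -, -, h⟩ := h
  refine ⟨RelIso.ofSurjective ψ fun x => ?_⟩
  rcases h x with ⟨a, -⟩ | h
  · exact hA.elim a
  · exact h

lemma Iso.isClosedEmbedding {G : SimpleGraph A} {H : SimpleGraph X} (φ : G ≃g H) :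
    IsClosedEmbedding φ.toEmbedding := fun _ y _ => φ.surjective y

lemma hLineGraph_congr {n : ℕ} (hn : 3 ≤ n) {G : SimpleGraph A} {H : SimpleGraph X}
    (h : Nonempty (G ≃g H)) :
    Nonempty (HLineGraph (pathGraph n) G ≃g HLineGraph (pathGraph n) H) := by
  obtain ⟨φ⟩ := h
  refine ⟨RelIso.ofSurjective (hLineEmbedding hn φ.toEmbedding (Iso.isClosedEmbedding φ)) ?_⟩
  rintro ⟨e, he⟩
  induction e with | _ x y =>
  obtain ⟨e, he, h'⟩ := exists_edge_map_eq (Iso.isClosedEmbedding φ) (φ.surjective x) he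
  exact ⟨⟨e, he⟩, Subtype.ext h'⟩

end Closed

/-! ### Termination, convergence and boundedness of the sequence -/

section Iterate

lemma iterHLineGraph_succ' {V : Type u} {W : Type v} (H : SimpleGraph W) (G : SimpleGraph V) :
    ∀ k, iterHLineGraph H G (k + 1) = iterHLineGraph H (HLineGraph H G) k
  | 0 => rfl
  | k + 1 => by
    change (⟨(iterHLineGraph H G (k + 1)).2.edgeSet, HLineGraph H (iterHLineGraph H G (k + 1)).2⟩ :
      (U : Type u) × SimpleGraph U) = _
    rw [iterHLineGraph_succ' H G k]
    rfl

instance finite_iterHLineGraph {V : Type u} [Finite V] {W : Type v} (H : SimpleGraph W)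
    (G : SimpleGraph V) : ∀ k, Finite (iterHLineGraph H G k).1
  | 0 => inferInstanceAs (Finite V)
  | k + 1 => by
    have := finite_iterHLineGraph H G k
    exact inferInstanceAs (Finite (iterHLineGraph H G k).2.edgeSet)

/-- The numbers of vertices of the iterated `P_n`-line graphs are unbounded. -/
def IsUnbounded {V : Type*} (n : ℕ) (G : SimpleGraph V) : Prop :=
  ∀ M, ∃ k, M ≤ Nat.card (iterHLineGraph (pathGraph n) G k).1

variable {V : Type u} {n : ℕ} {G : SimpleGraph V}

lemma IsUnbounded.of_hLineGraph (h : IsUnbounded n (HLineGraph (pathGraph n) G)) :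
    IsUnbounded n G := by
  intro M
  obtain ⟨k, hk⟩ := h M
  exact ⟨k + 1, by rwa [iterHLineGraph_succ']⟩

lemma hlTerminates_of_hLineGraph
    (h : HLTerminates (pathGraph n) (HLineGraph (pathGraph n) G)) :
    HLTerminates (pathGraph n) G := by
  obtain ⟨k, hk⟩ := h
  exact ⟨k + 1, by rwa [iterHLineGraph_succ']⟩

lemma iterHLineGraph_iso_of_le (hn : 3 ≤ n) {N : ℕ}
    (h : Nonempty ((iterHLineGraph (pathGraph n) G N).2 ≃g
      (iterHLineGraph (pathGraph n) G (N + 1)).2)) {k : ℕ} (hk : N ≤ k) :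
    Nonempty ((iterHLineGraph (pathGraph n) G k).2 ≃g
      (iterHLineGraph (pathGraph n) G (k + 1)).2) := by
  induction k, hk using Nat.le_induction with
  | base => exact h
  | succ k _ ih => exact hLineGraph_congr hn ih

/-- Two isomorphic consecutive terms make all later ones isomorphic, so only finitely many vertex
counts occur. -/
lemma HLConverges.not_isUnbounded [Finite V] (hn : 3 ≤ n)
    (h : HLConverges (pathGraph n) G) : ¬ IsUnbounded n G := by
  obtain ⟨-, N, hN⟩ := h
  have hcard : ∀ k, N ≤ k → Nat.card (iterHLineGraph (pathGraph n) G k).1 =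
      Nat.card (iterHLineGraph (pathGraph n) G N).1 := by
    intro k hk
    induction k, hk using Nat.le_induction with
    | base => rfl
    | succ k hk ih =>
      rw [← ih]
      obtain ⟨φ⟩ := iterHLineGraph_iso_of_le hn hN hk
      exact (Nat.card_congr φ.toEquiv).symm
  intro hu
  obtain ⟨k, hk⟩ := hu (∑ i ∈ Finset.range (N + 1),
    Nat.card (iterHLineGraph (pathGraph n) G i).1 + 1)
  have hle : ∀ i, i ≤ N → Nat.card (iterHLineGraph (pathGraph n) G i).1 ≤
      ∑ i ∈ Finset.range (N + 1), Nat.card (iterHLineGraph (pathGraph n) G i).1 := fun i hi =>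
    Finset.single_le_sum (f := fun i => Nat.card (iterHLineGraph (pathGraph n) G i).1)
      (fun _ _ => Nat.zero_le _) (Finset.mem_range.2 (by omega))
  rcases le_total k N with h | h
  · have := hle k h
    omega
  · have := hle N le_rfl
    rw [hcard k h] at hk
    omega

lemma iterHLineGraph_eq_bot_of_le {k m : ℕ}
    (h : (iterHLineGraph (pathGraph n) G k).2 = ⊥) (hkm : k ≤ m) :
    (iterHLineGraph (pathGraph n) G m).2 = ⊥ := by
  induction m, hkm using Nat.le_induction with
  | base => exact h
  | succ m _ ih =>
    have : IsEmpty (iterHLineGraph (pathGraph n) G (m + 1)).1 := by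
      change IsEmpty (iterHLineGraph (pathGraph n) G m).2.edgeSet
      rw [ih]; simp
    exact Subsingleton.elim _ _

/-- An edgeless term may still have vertices; only its successors have none, hence the strict
inequality. -/
lemma iterHLineGraph_isEmpty_of_lt {k m : ℕ}
    (h : (iterHLineGraph (pathGraph n) G k).2 = ⊥) (hkm : k < m) :
    IsEmpty (iterHLineGraph (pathGraph n) G m).1 := by
  obtain ⟨m, rfl⟩ := Nat.exists_eq_add_of_lt hkm
  change IsEmpty (iterHLineGraph (pathGraph n) G (k + m)).2.edgeSet
  rw [iterHLineGraph_eq_bot_of_le h (Nat.le_add_right k m)]; simp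

lemma Splits.isUnbounded {A B X : Type u} [Finite X] (hn : 3 ≤ n) {G : SimpleGraph A}
    {H : SimpleGraph B} {K : SimpleGraph X} (h : Splits G H K) (hu : IsUnbounded n G) :
    IsUnbounded n K := by
  intro M
  obtain ⟨k, hk⟩ := hu M
  obtain ⟨φ, -⟩ := h.iter hn k
  exact ⟨k, hk.trans (Nat.card_le_card_of_injective φ φ.injective)⟩

lemma HLTerminates.congr {V' : Type u} {G' : SimpleGraph V'} (h : HLTerminates (pathGraph n) G)
    {N : ℕ}
    (hiso : ∀ k, N ≤ k → Nonempty ((iterHLineGraph (pathGraph n) G k).2 ≃g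
      (iterHLineGraph (pathGraph n) G' k).2)) : HLTerminates (pathGraph n) G' := by
  obtain ⟨k, hk⟩ := h
  refine ⟨max k N, ?_⟩
  obtain ⟨φ⟩ := hiso (max k N) (le_max_right _ _)
  have hb := iterHLineGraph_eq_bot_of_le hk (le_max_left k N)
  ext x y
  have := φ.symm.map_rel_iff (a := x) (b := y)
  simp_all

lemma HLConverges.congr {V' : Type u} {G' : SimpleGraph V'} (hn : 3 ≤ n)
    (h : HLConverges (pathGraph n) G) {N : ℕ}
    (hiso : ∀ k, N ≤ k → Nonempty ((iterHLineGraph (pathGraph n) G k).2 ≃g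
      (iterHLineGraph (pathGraph n) G' k).2)) : HLConverges (pathGraph n) G' := by
  obtain ⟨ht, M, hM⟩ := h
  refine ⟨fun ht' => ht (ht'.congr fun k hk => (hiso k hk).map RelIso.symm), max M N, ?_⟩
  obtain ⟨φ⟩ := hiso (max M N) (le_max_right _ _)
  obtain ⟨ψ⟩ := hiso (max M N + 1) (by omega)
  obtain ⟨χ⟩ := iterHLineGraph_iso_of_le hn hM (le_max_left M N)
  exact ⟨(φ.symm.trans χ).trans ψ⟩

/-- A terminating union of components may be dropped. -/
lemma Splits.hlConverges {A B X : Type u} (hn : 3 ≤ n) {G : SimpleGraph A}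
    {H : SimpleGraph B} {K : SimpleGraph X} (h : Splits G H K) (hG : HLTerminates (pathGraph n) G)
    (hK : HLConverges (pathGraph n) K) : HLConverges (pathGraph n) H := by
  obtain ⟨k, hk⟩ := hG
  refine hK.congr hn (N := k + 1) fun m hm => ?_
  exact ((h.iter hn m).nonempty_iso (iterHLineGraph_isEmpty_of_lt hk hm)).map RelIso.symm

lemma HLConverges.hLineGraph (hn : 3 ≤ n) (h : HLConverges (pathGraph n) G) :
    HLConverges (pathGraph n) (HLineGraph (pathGraph n) G) := by
  obtain ⟨ht, N, hN⟩ := h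
  refine ⟨fun h => ht (hlTerminates_of_hLineGraph h), N, ?_⟩
  rw [← iterHLineGraph_succ', ← iterHLineGraph_succ']
  exact iterHLineGraph_iso_of_le hn hN (Nat.le_succ N)

lemma HLConverges.of_hLineGraph (h : HLConverges (pathGraph n) (HLineGraph (pathGraph n) G)) :
    HLConverges (pathGraph n) G := by
  obtain ⟨ht, N, hN⟩ := h
  rw [← iterHLineGraph_succ', ← iterHLineGraph_succ'] at hN
  refine ⟨fun ⟨k, hk⟩ => ht ⟨k, ?_⟩, N + 1, hN⟩
  rw [← iterHLineGraph_succ']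
  exact iterHLineGraph_eq_bot_of_le hk (Nat.le_succ k)

end Iterate

/-! ### Long paths in the iterates -/

section LongPaths

/-- The iterates of `pathLine n` on `G`. -/
def iterPathLine {V : Type u} (n : ℕ) (G : SimpleGraph V) : ℕ → (U : Type u) × SimpleGraph U
  | 0 => ⟨V, G⟩
  | k + 1 => ⟨Sym2 (iterPathLine n G k).1, pathLine n (iterPathLine n G k).2⟩

/-- The iterated `P_n`-line graphs contain arbitrarily long paths. -/
def HasLongPaths {V : Type u} (n : ℕ) (G : SimpleGraph V) : Prop :=
  ∀ M, ∃ (k : ℕ) (l : List (iterPathLine n G k).1),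
    l.IsChain (iterPathLine n G k).2.Adj ∧ l.Nodup ∧ M ≤ l.length

variable {V : Type u} {n : ℕ} {G : SimpleGraph V}

lemma iterPathLine_succ' (n : ℕ) (G : SimpleGraph V) :
    ∀ k, iterPathLine n G (k + 1) = iterPathLine n (pathLine n G) k
  | 0 => rfl
  | k + 1 => by
    change (⟨Sym2 (iterPathLine n G (k + 1)).1, pathLine n (iterPathLine n G (k + 1)).2⟩ :
      (U : Type u) × SimpleGraph U) = _
    rw [iterPathLine_succ' n G k]
    rfl

lemma HasLongPaths.of_pathLine (h : HasLongPaths n (pathLine n G)) : HasLongPaths n G := by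
  intro M
  obtain ⟨k, h⟩ := h M
  refine ⟨k + 1, ?_⟩
  rwa [iterPathLine_succ']

/-- Unordered pairs that are not edges survive in `iterPathLine` only as isolated vertices. The
embedding reaches every other vertex, so paths with an edge transfer to the actual sequence. -/
lemma exists_embedding_iterPathLine (hn : 3 ≤ n) (G : SimpleGraph V) :
    ∀ k, ∃ φ : (iterHLineGraph (pathGraph n) G k).2 ↪g (iterPathLine n G k).2,
      ∀ x y, (iterPathLine n G k).2.Adj x y → x ∈ Set.range φ
  | 0 => ⟨Embedding.refl, fun x _ _ => ⟨x, rfl⟩⟩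
  | k + 1 => by
    obtain ⟨φ, hφ⟩ := exists_embedding_iterPathLine hn G k
    have hc : IsClosedEmbedding φ := fun x y h => hφ y (φ x) h.symm
    refine ⟨⟨⟨fun e => e.1.map φ, ?_⟩, ?_⟩, ?_⟩
    · exact fun e f h => Subtype.ext (Sym2.map.injective φ.injective h)
    · intro e f
      exact (pathAdj_map_iff hc).trans (hLineGraph_adj_iff hn).symm
    · intro e f h
      have he : e ∈ (iterPathLine n G k).2.edgeSet := PathAdj.left_mem h
      revert he
      refine Sym2.ind (fun x y he => ?_) e
      obtain ⟨e, he, h'⟩ := exists_edge_map_eq hc (hφ x y he) he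
      exact ⟨⟨e, he⟩, h'⟩

lemma HasLongPaths.isUnbounded [Finite V] (hn : 3 ≤ n) (h : HasLongPaths n G) :
    IsUnbounded n G := by
  intro M
  -- The surplus of two ensures that the path has an edge, so that its first vertex is not isolated.
  obtain ⟨k, l, h₁, h₂, h₃⟩ := h (M + 2)
  refine ⟨k, ?_⟩
  obtain ⟨φ, hφ⟩ := exists_embedding_iterPathLine hn G k
  have hc : IsClosedEmbedding φ := fun x y h => hφ y (φ x) h.symm
  match l, h₁, h₂, h₃ with
  | x :: y :: l, h₁, h₂, h₃ =>
    obtain ⟨l', hl', -⟩ := exists_map_eq_of_closed hc h₁ (x := x) (by simp)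
      (hφ x y (by simp_all))
    rw [← hl'] at h₂ h₃
    have hnd := h₂.of_map φ
    have := Fintype.ofFinite (iterHLineGraph (pathGraph n) G k).1
    have := hnd.length_le_card
    rw [Nat.card_eq_fintype_card]
    simp at h₃
    omega
  | [], _, _, h₃ => simp at h₃
  | [_], _, _, h₃ => simp at h₃

end LongPaths

/-! ### Gluing and disjointness of edge lists -/

section LinkEdges
variable {V : Type*} {G : SimpleGraph V} {n : ℕ}

lemma isChain_adj_reverse {l : List V} : l.reverse.IsChain G.Adj ↔ l.IsChain G.Adj := by
  rw [List.isChain_reverse]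
  simp only [adj_comm]

/-- With an overlap of two vertices, every vertex triple of the glued list lies in one of the two
pieces. -/
lemma linkEdges_append_chain {R : Sym2 V → Sym2 V → Prop} {l₁ m l₂ : List V}
    (h₁ : (linkEdges (l₁ ++ m)).IsChain R) (h₂ : (linkEdges (m ++ l₂)).IsChain R)
    (hm : 2 ≤ m.length) : (linkEdges (l₁ ++ m ++ l₂)).IsChain R := by
  match m, hm with
  | y :: z :: m, _ =>
    rw [linkEdges_append] at h₁
    rw [List.append_assoc, List.cons_append, linkEdges_append]
    simp only [List.cons_append, linkEdges_cons_cons] at h₁ h₂ ⊢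
    have := List.IsChain.append_overlap (l₁ := linkEdges (l₁ ++ [y])) (l₂ := [s(y, z)]) ?_ h₂
      (by simp)
    · simpa using this
    exact h₁.infix ⟨[], linkEdges (z :: m), by simp⟩

lemma linkEdges_infix {l l' : List V} (h : l <:+: l') : linkEdges l <:+: linkEdges l' := by
  obtain ⟨s, t, rfl⟩ := h
  cases l with
  | nil => simp
  | cons a l =>
    rw [List.append_assoc, List.cons_append, linkEdges_append]
    rcases List.eq_nil_or_concat l with rfl | ⟨l, b, rfl⟩
    · simp
    · refine ⟨linkEdges (s ++ [a]), linkEdges (b :: t), ?_⟩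
      have := linkEdges_append (a :: l) b t
      simp at this ⊢
      exact this.symm

lemma isChain_linkEdges_of_infix {R : Sym2 V → Sym2 V → Prop} {l l' : List V}
    (h : (linkEdges l').IsChain R) (hl : l <:+: l') : (linkEdges l).IsChain R :=
  h.infix (linkEdges_infix hl)

lemma disjoint_linkEdges {l l' : List V} (h : l.Nodup)
    (h' : ∀ x y, x ∈ l → x ∈ l' → y ∈ l → y ∈ l' → x = y) :
    (linkEdges l).Disjoint (linkEdges l') := by
  intro e he he'
  obtain ⟨l₁, a, b, l₂, rfl, rfl⟩ := mem_linkEdges_iff.1 he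
  have := h' a b (by simp) (mem_of_mem_linkEdges he' (by simp)) (by simp)
    (mem_of_mem_linkEdges he' (by simp))
  subst this
  simp [List.nodup_append] at h

lemma eq_nil_of_mem_linkEdges {l₁ m l₂ : List V} {a b : V} (h : (l₁ ++ a :: (m ++ b :: l₂)).Nodup)
    (he : s(a, b) ∈ linkEdges (l₁ ++ a :: (m ++ b :: l₂))) : m = [] := by
  rw [linkEdges_append, List.mem_append] at he
  rcases he with he | he
  · have := mem_of_mem_linkEdges he (x := b) (by simp)
    simp [List.nodup_append] at h
    grind
  · cases m with
    | nil => rfl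
    | cons x m =>
      simp only [List.cons_append, linkEdges_cons_cons, List.mem_cons] at he
      rcases he with he | he
      · simp [List.nodup_append] at h
        grind
      · have := mem_of_mem_linkEdges he (x := a) (by simp)
        simp [List.nodup_append] at h
        grind

end LinkEdges

/-! ### Self-reproducing configurations -/

section Chords
variable {V : Type u} {G : SimpleGraph V} {n : ℕ}

/-- A path with at least `N` vertices whose first vertex is adjacent to the last two. -/
def HasDoubleChord (G : SimpleGraph V) (N : ℕ) : Prop :=
  ∃ (a : V) (m : List V) (b c : V), (a :: (m ++ [b, c])).IsChain G.Adj ∧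
    (a :: (m ++ [b, c])).Nodup ∧ G.Adj a b ∧ G.Adj a c ∧ N ≤ (a :: (m ++ [b, c])).length

/-- Prolong the edges of the path a, x, …, b, c by the chords ac and ab. The first edge ax meets
both at a, so the configuration reproduces itself; one vertex is lost and two are gained. -/
lemma HasDoubleChord.pathLine (hn : 4 ≤ n) {N : ℕ} (hN : n ≤ N) (h : HasDoubleChord G N) :
    HasDoubleChord (pathLine n G) (N + 1) := by
  obtain ⟨a, m, b, c, h₁, h₂, hab, hac, h₃⟩ := h
  match m, h₁, h₂, h₃ with
  | [], _, _, h₃ => simp at h₃; omega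
  | x :: m, h₁, h₂, h₃ =>
    have hp := isChain_pathLine (n := n) h₁ h₂ (by omega)
    simp only [List.cons_append, linkEdges_cons_cons, List.isChain_cons_cons] at h₁ hp
    obtain ⟨hax, h₁⟩ := h₁
    have hbc : G.Adj b c := by
      have : ((x :: m) ++ b :: c :: []).IsChain G.Adj := h₁
      rw [List.isChain_append_cons_cons] at this
      exact this.2.1
    have hxm : ((x :: m) ++ [b]).IsChain G.Adj := h₁.infix ⟨[], [c], by simp⟩
    have hlen : n ≤ m.length + 4 := by simp at h₃; omega
    have hend : (_root_.pathLine n G).Adj s(b, c) s(a, c) := by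
      refine ⟨x :: m, b, c, a, [], ?_, ?_, by simp; omega, rfl, Sym2.eq_swap⟩
      · rw [List.isChain_append_cons_cons]
        exact ⟨hxm, hbc, by simp [hac.symm]⟩
      · simp [List.nodup_append] at h₂ ⊢; grind
    have hchord : (_root_.pathLine n G).Adj s(a, c) s(a, b) := by
      refine ⟨[], c, a, b, (x :: m).reverse, ?_, ?_, by simp; omega, Sym2.eq_swap, rfl⟩
      · have : ((x :: m) ++ [b]).reverse.IsChain G.Adj := isChain_adj_reverse.2 hxm
        simp at this ⊢
        exact ⟨hac.symm, hab, this⟩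
      · simp [List.nodup_append] at h₂ ⊢; grind
    refine ⟨s(a, x), linkEdges (x :: (m ++ [b, c])), s(a, c), s(a, b), ?_, ?_, ?_, ?_, ?_⟩
    · have e : linkEdges (a :: ((x :: m) ++ [b, c])) =
          linkEdges (a :: (x :: m) ++ [b]) ++ [s(b, c)] := by
        have := linkEdges_append (a :: (x :: m)) b [c]
        simpa using this
      have h4 : s(a, x) :: (linkEdges (x :: (m ++ [b, c])) ++ [s(a, c), s(a, b)]) =
          linkEdges (a :: (x :: m) ++ [b]) ++ [s(b, c)] ++ [s(a, c), s(a, b)] := by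
        rw [← e]; simp
      rw [h4]
      refine List.IsChain.append_overlap ?_ ?_ (by simp)
      · rw [← e]; simpa using hp
      · simp [hend, hchord]
    · have hnd := linkEdges_nodup h₂
      have h5 : ∀ y, s(a, y) ∉ linkEdges (x :: (m ++ [b, c])) := by
        intro y hy
        have := mem_of_mem_linkEdges hy (x := a) (by simp)
        simp [List.nodup_append] at h₂ this; grind
      have h6 : (linkEdges (x :: (m ++ [b, c]))).Nodup :=
        linkEdges_nodup (List.nodup_cons.1 h₂).2
      simp only [List.nodup_cons, List.nodup_append, List.mem_append, List.mem_cons]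
      simp [List.nodup_append] at h₂
      simp
      grind
    · have : PathAdj n G s(c, a) s(a, x) := by
        refine ⟨[], c, a, x, m ++ [b], ?_, ?_, by simp; omega, rfl, rfl⟩
        · simp [hac.symm, hax]
          exact hxm
        · simp [List.nodup_append] at h₂ ⊢; grind
      rw [Sym2.eq_swap (a := a) (b := c)]
      exact this.symm
    · have : PathAdj n G s(b, a) s(a, x) := by
        refine ⟨[c], b, a, x, m, ?_, ?_, by simp; omega, rfl, rfl⟩
        · simp [hab.symm, hax, hbc.symm]
          exact hxm.infix ⟨[], [b], by simp⟩
        · simp [List.nodup_append] at h₂ ⊢; grind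
      rw [Sym2.eq_swap (a := a) (b := b)]
      exact this.symm
    · simp at h₃ ⊢; omega

lemma HasDoubleChord.iter (hn : 4 ≤ n) {N : ℕ} (hN : n ≤ N) (h : HasDoubleChord G N) :
    ∀ k, HasDoubleChord (iterPathLine n G k).2 (N + k)
  | 0 => h
  | k + 1 => (HasDoubleChord.iter hn hN h k).pathLine hn (hN.trans (Nat.le_add_right N k))

lemma HasDoubleChord.hasLongPaths (hn : 4 ≤ n) (h : HasDoubleChord G n) : HasLongPaths n G := by
  intro M
  obtain ⟨a, m, b, c, h₁, h₂, -, -, h₃⟩ := h.iter hn le_rfl M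
  exact ⟨M, _, h₁, h₂, by omega⟩

/-- A cycle with at least `n` vertices, together with a further edge attached to it, yields long
paths. -/
lemma hasLongPaths_of_pendant (hn : 4 ≤ n) {K : List V} {b c : V} (h₁ : (b :: K).IsChain G.Adj)
    (h₂ : (K ++ [b, c]).IsChain G.Adj) (h₃ : (K ++ [b, c]).Nodup) (h₄ : n ≤ K.length + 1) :
    HasLongPaths n G := by
  apply HasLongPaths.of_pathLine
  refine HasDoubleChord.hasLongPaths hn ?_
  match K, h₁, h₂, h₃, h₄ with
  | [], _, _, _, h₄ => simp at h₄; omega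
  | [_], _, _, _, h₄ => simp at h₄; omega
  | a :: x :: K, h₁, h₂, h₃, h₄ =>
    rcases List.eq_nil_or_concat (K) with rfl | ⟨m, y, rfl⟩
    · simp at h₄; omega
    have hp := isChain_pathLine (n := n) h₂ h₃ (by simp at h₄ ⊢; omega)
    simp at h₁ h₂
    obtain ⟨hba, hax, hK⟩ := h₁
    obtain ⟨-, h₂⟩ := h₂
    obtain ⟨hxy, hyb, hbc⟩ := h₂
    have hlen : n ≤ m.length + 4 := by simp at h₄; omega
    have hrev : ((x :: m) ++ [y]).reverse.IsChain G.Adj := isChain_adj_reverse.2 hxy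
    -- Run once round the cycle from ba to yb, then out along bc; the first edge ba meets the last
    -- two at b.
    refine ⟨s(b, a), linkEdges (a :: x :: (m ++ [y])), s(y, b), s(b, c), ?_, ?_, ?_, ?_, ?_⟩
    · have e : linkEdges (a :: x :: (m ++ [y])) ++ [s(y, b), s(b, c)] =
          linkEdges (a :: x :: (m ++ [y]) ++ [b, c]) := by
        have := linkEdges_append (a :: x :: m) y [b, c]
        simp at this ⊢
        rw [this]
      rw [e]
      simp at hp ⊢
      refine ⟨⟨[], b, a, x, m ++ [y], ?_, ?_, by simp; omega, rfl, rfl⟩, hp⟩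
      · simpa [hba, hax] using hK
      · simp [List.nodup_append] at h₃ ⊢; grind
    · have e : linkEdges (a :: x :: (m ++ [y])) ++ [s(y, b), s(b, c)] =
          linkEdges (a :: x :: (m ++ [y]) ++ [b, c]) := by
        have := linkEdges_append (a :: x :: m) y [b, c]
        simp at this ⊢
        rw [this]
      rw [e, List.nodup_cons]
      refine ⟨fun hm => ?_, linkEdges_nodup (by simpa using h₃)⟩
      rw [Sym2.eq_swap] at hm
      have := eq_nil_of_mem_linkEdges (l₁ := []) (a := a) (m := x :: (m ++ [y])) (b := b)
        (l₂ := [c]) (by simpa using h₃) (by simpa using hm)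
      simp at this
    · have : PathAdj n G s(a, b) s(b, y) := by
        refine ⟨[], a, b, y, (x :: m).reverse, ?_, ?_, by simp; omega, rfl, rfl⟩
        · simp at hrev ⊢
          exact ⟨hba.symm, hyb.symm, hrev⟩
        · simp [List.nodup_append] at h₃ ⊢; grind
      rw [Sym2.eq_swap, Sym2.eq_swap (a := y)]
      exact this
    · have : PathAdj n G s(a, b) s(b, c) := by
        refine ⟨(x :: (m ++ [y])).reverse, a, b, c, [], ?_, ?_, by simp; omega, rfl, rfl⟩
        · rw [List.isChain_append_cons_cons]
          refine ⟨?_, hba.symm, by simpa using hbc⟩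
          have : (a :: x :: (m ++ [y])).reverse.IsChain G.Adj :=
            isChain_adj_reverse.2 (by simpa [hax] using hK)
          simpa using this
        · simp [List.nodup_append] at h₃ ⊢; grind
      rw [Sym2.eq_swap]
      exact this
    · simp at h₄ ⊢; omega

end Chords

/-! ### Distinctness by counting -/

section Nodup
variable {V : Type*}

-- Reduces distinctness of rearranged sublists to linear arithmetic on multiplicities.
open Classical in
lemma nodup_of_count_le {l l' : List V} (h : l'.Nodup) (H : ∀ a, l.count a ≤ l'.count a) :
    l.Nodup := by
  rw [List.nodup_iff_count_le_one] at h ⊢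
  exact fun a => (H a).trans (h a)

lemma disjoint_linkEdges_of_eq {l l' : List V} (u : V) (h : l.Nodup)
    (h' : ∀ x ∈ l, x ∈ l' → x = u) : (linkEdges l).Disjoint (linkEdges l') :=
  disjoint_linkEdges h fun x y hx hx' hy hy' => (h' x hx hx').trans (h' y hy hy').symm

lemma disjoint_linkEdges_concat {A B C : List V} {u w : V} (nd : (A ++ (B ++ C)).Nodup)
    (hu : u ∈ B) (hw : w ∈ C) : (linkEdges (A ++ [u])).Disjoint (linkEdges (B ++ [w])) := by
  obtain ⟨h₁, h₂, h₃⟩ := List.nodup_append'.1 nd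
  rw [List.disjoint_append_right] at h₃
  have h₄ := (List.nodup_append'.1 h₂).2.2
  refine disjoint_linkEdges_of_eq u ?_ ?_
  · rw [List.nodup_append']
    exact ⟨h₁, by simp, by simpa using fun h => h₃.1 h hu⟩
  · intro x hx hx'
    rw [List.mem_append, List.mem_singleton] at hx hx'
    rcases hx with hx | hx
    · rcases hx' with hx' | rfl
      · exact (h₃.1 hx hx').elim
      · exact (h₃.2 hx hw).elim
    · exact hx

end Nodup

/-! ### Cycles with two or three tails -/

section Tails
variable {V : Type u} {G : SimpleGraph V} {n : ℕ}

/-- A cycle made of the arcs `a₀`, `a₁`, with tails `t₀`, `t₁` ending at the first vertices of the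
arcs, such that the cycle and either tail together have at least `n` vertices. -/
structure TwoTail (n : ℕ) (G : SimpleGraph V) (t₀ a₀ t₁ a₁ : List V) : Prop where
  chain₀ : (t₀ ++ a₀ ++ a₁).IsChain G.Adj
  chain₁ : (t₁ ++ a₁ ++ a₀).IsChain G.Adj
  nodup : (t₀ ++ a₀ ++ (t₁ ++ a₁)).Nodup
  arc₀ : a₀ ≠ []
  arc₁ : a₁ ≠ []
  cycle : 3 ≤ a₀.length + a₁.length
  long₀ : n ≤ t₀.length + a₀.length + a₁.length
  long₁ : n ≤ t₁.length + a₀.length + a₁.length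

/-- The cycle absorbs the last edge pu₀ of the first tail: that tail shrinks by one, its arc grows
by one, and the second tail keeps its length. -/
lemma TwoTail.pathLine {s : List V} {p u₀ : V} {b₀ t₁ : List V} {u₁ : V} {b₁ : List V}
    (h : TwoTail n G (s ++ [p]) (u₀ :: b₀) t₁ (u₁ :: b₁)) :
    TwoTail n (pathLine n G) (linkEdges (s ++ [p])) (linkEdges (p :: u₀ :: (b₀ ++ [u₁])))
      (linkEdges (t₁ ++ [u₁])) (linkEdges (u₁ :: (b₁ ++ [u₀]))) := by
  obtain ⟨c₀, c₁, nd, -, -, cyc, l₀, l₁⟩ := h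
  -- All adjacencies come from three long paths: in along either tail and round the cycle (`P₀`,
  -- `P₁`), or round the cycle to u₀ and out along the first tail (`P₂`).
  have P₀ : (linkEdges (s ++ p :: u₀ :: b₀ ++ u₁ :: b₁)).IsChain (_root_.pathLine n G).Adj := by
    have := isChain_pathLine (n := n) c₀
      (nodup_of_count_le nd fun a => by simp [List.count_cons])
      (by simp at l₀ ⊢; omega)
    simpa using this
  have P₁ : (linkEdges (t₁ ++ u₁ :: b₁ ++ u₀ :: b₀)).IsChain (_root_.pathLine n G).Adj :=
    isChain_pathLine c₁ (nodup_of_count_le nd fun a => by simp [List.count_cons]; omega)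
      (by simp at l₁ ⊢; omega)
  have P₂ : (linkEdges (b₀ ++ u₁ :: b₁ ++ u₀ :: p :: s.reverse)).IsChain
      (_root_.pathLine n G).Adj := by
    refine isChain_pathLine ?_ (nodup_of_count_le nd fun a => by simp [List.count_cons]; omega)
      (by simp at l₀ ⊢; omega)
    have h₁ : (b₀ ++ u₁ :: b₁).IsChain G.Adj := c₀.infix ⟨s ++ [p, u₀], [], by simp⟩
    have h₂ : (u₁ :: b₁ ++ [u₀]).IsChain G.Adj := c₁.infix ⟨t₁, b₀, by simp⟩
    have h₃ : (s ++ [p, u₀]).reverse.IsChain G.Adj :=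
      isChain_adj_reverse.2 (c₀.infix ⟨[], b₀ ++ u₁ :: b₁, by simp⟩)
    have h₄ := List.IsChain.append_overlap h₁ h₂ (by simp)
    have h₅ := List.IsChain.append_overlap (l₁ := b₀ ++ u₁ :: b₁) (l₂ := [u₀])
      (l₃ := p :: s.reverse) h₄ (by simpa using h₃) (by simp)
    simpa using h₅
  have e₀ : linkEdges (s ++ [p]) ++ linkEdges (p :: u₀ :: (b₀ ++ [u₁])) =
      linkEdges (s ++ p :: u₀ :: (b₀ ++ [u₁])) := (linkEdges_append _ _ _).symm
  have e₁ : linkEdges (t₁ ++ [u₁]) ++ linkEdges (u₁ :: (b₁ ++ [u₀])) =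
      linkEdges (t₁ ++ u₁ :: (b₁ ++ [u₀])) := (linkEdges_append _ _ _).symm
  refine ⟨?_, ?_, ?_, by simp, ?_, ?_, ?_, ?_⟩
  · have := linkEdges_append_chain (R := (_root_.pathLine n G).Adj) (l₁ := s ++ [p, u₀])
      (m := b₀ ++ u₁ :: b₁) (l₂ := [u₀]) (by simpa using P₀)
      (isChain_linkEdges_of_infix P₂ ⟨[], p :: s.reverse, by simp⟩) (by simp at cyc ⊢; omega)
    rw [e₀]
    have e := linkEdges_append (s ++ p :: u₀ :: b₀) u₁ (b₁ ++ [u₀])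
    simp at e this ⊢
    rwa [← e]
  · rw [e₁]
    have h₁ := linkEdges_append_chain (R := (_root_.pathLine n G).Adj) (l₁ := t₁)
      (m := u₁ :: b₁ ++ [u₀]) (l₂ := [p])
      (isChain_linkEdges_of_infix P₁ ⟨[], b₀, by simp⟩)
      (isChain_linkEdges_of_infix P₂ ⟨b₀, s.reverse, by simp⟩) (by simp)
    have e := linkEdges_append (t₁ ++ u₁ :: b₁) u₀ [p]
    have h₂ : (linkEdges (p :: u₀ :: (b₀ ++ [u₁]))).IsChain (_root_.pathLine n G).Adj :=
      isChain_linkEdges_of_infix P₀ ⟨s, b₁, by simp⟩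
    have h₃ := List.IsChain.append_overlap (l₁ := linkEdges (t₁ ++ u₁ :: (b₁ ++ [u₀])))
      (l₂ := [s(p, u₀)]) (l₃ := linkEdges (u₀ :: (b₀ ++ [u₁])))
      (by simp at e h₁; rwa [e, Sym2.eq_swap] at h₁) (by simpa using h₂) (by simp)
    simpa using h₃
  · rw [e₀, e₁]
    refine List.nodup_append'.2 ⟨linkEdges_nodup ?_, linkEdges_nodup ?_, ?_⟩
    · (refine nodup_of_count_le nd fun a => ?_; simp [List.count_cons]; omega)
    · (refine nodup_of_count_le nd fun a => ?_; simp [List.count_cons]; omega)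
    · intro e he he'
      obtain ⟨l₁, x, y, l₂, hl, rfl⟩ := mem_linkEdges_iff.1 he
      have hx := mem_of_mem_linkEdges he (x := x) (by simp)
      have hy := mem_of_mem_linkEdges he (x := y) (by simp)
      have hx' := mem_of_mem_linkEdges he' (x := x) (by simp)
      have hy' := mem_of_mem_linkEdges he' (x := y) (by simp)
      have n₀ : (s ++ [p] ++ u₀ :: (b₀ ++ u₁ :: [])).Nodup := by
        (refine nodup_of_count_le nd fun a => ?_; simp [List.count_cons]; omega)
      have n₁ : (t₁ ++ u₁ :: (b₁ ++ u₀ :: [])).Nodup := by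
        (refine nodup_of_count_le nd fun a => ?_; simp [List.count_cons]; omega)
      have hxy : x ≠ y := by
        have : (s ++ [p] ++ u₀ :: (b₀ ++ u₁ :: [])) = l₁ ++ x :: y :: l₂ := by simpa using hl
        rw [this] at n₀
        rintro rfl
        simp [List.nodup_append] at n₀
      -- The two pieces share only the vertices u₀ and u₁. If u₀u₁ were an edge of both, both arcs
      -- would be single vertices, against `cyc`.
      have hxy' : s(x, y) = s(u₀, u₁) := by
        have hd := (List.nodup_append'.1 nd).2.2
        have aux : ∀ z, z ∈ s ++ p :: u₀ :: (b₀ ++ [u₁]) → z ∈ t₁ ++ u₁ :: (b₁ ++ [u₀]) →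
            z = u₀ ∨ z = u₁ := by
          intro z hz hz'
          by_contra! hc
          refine hd (a := z) ?_ ?_
          · simp at hz ⊢; tauto
          · simp at hz' ⊢; tauto
        have h₁ := aux x hx hx'
        have h₂ := aux y hy hy'
        rcases h₁ with rfl | rfl <;> rcases h₂ with rfl | rfl
        · exact absurd rfl hxy
        · rfl
        · exact Sym2.eq_swap
        · exact absurd rfl hxy
      rw [hxy'] at he he'
      have := eq_nil_of_mem_linkEdges n₀ (by simpa using he)
      rw [Sym2.eq_swap] at he'
      have := eq_nil_of_mem_linkEdges n₁ (by simpa using he')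
      simp_all
  · intro h
    have := congrArg List.length h
    simp at this
  all_goals simp at cyc l₀ l₁ ⊢; omega

/-- Once the first tail is used up, `long₀` says that the cycle alone has at least n vertices, and
the second tail supplies a pendant edge. -/
lemma TwoTail.hasLongPaths (hn : 4 ≤ n) {t₀ a₀ t₁ a₁ : List V} (h : TwoTail n G t₀ a₀ t₁ a₁)
    (ht : t₁ ≠ []) : HasLongPaths n G := by
  induction hk : t₀.length generalizing V with
  | zero =>
    obtain rfl := List.length_eq_zero_iff.1 hk
    obtain ⟨c₀, c₁, nd, h₀, h₁, cyc, l₀, l₁⟩ := h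
    obtain ⟨s, p, rfl⟩ := (List.eq_nil_or_concat t₁).resolve_left ht
    obtain ⟨u₀, b₀, rfl⟩ := List.exists_cons_of_ne_nil h₀
    obtain ⟨u₁, b₁, rfl⟩ := List.exists_cons_of_ne_nil h₁
    refine hasLongPaths_of_pendant hn (K := b₁ ++ u₀ :: b₀) (b := u₁) (c := p) ?_ ?_ ?_ ?_
    · exact c₁.infix ⟨s ++ [p], [], by simp⟩
    · have h₁ : (b₁ ++ u₀ :: b₀).IsChain G.Adj := c₁.infix ⟨s ++ [p, u₁], [], by simp⟩
      have h₂ : (u₀ :: b₀ ++ [u₁]).IsChain G.Adj := c₀.infix ⟨[], b₁, by simp⟩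
      have h₃ := List.IsChain.append_overlap h₁ h₂ (by simp)
      have h₄ : G.Adj u₁ p := by
        have : [p, u₁].IsChain G.Adj := c₁.infix ⟨s, b₁ ++ u₀ :: b₀, by simp⟩
        simpa [adj_comm] using this
      have h₅ := List.IsChain.append_overlap (l₂ := [u₁]) (l₃ := [p]) h₃ (by simpa using h₄)
        (by simp)
      simpa using h₅
    · (refine nodup_of_count_le nd fun a => ?_; simp [List.count_cons]; omega)
    · simp at l₀ ⊢; omega
  | succ k ih =>
    obtain ⟨s, p, rfl⟩ := (List.eq_nil_or_concat t₀).resolve_left (by rintro rfl; simp at hk)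
    obtain ⟨u₀, b₀, rfl⟩ := List.exists_cons_of_ne_nil h.arc₀
    obtain ⟨u₁, b₁, rfl⟩ := List.exists_cons_of_ne_nil h.arc₁
    apply HasLongPaths.of_pathLine
    rw [List.concat_eq_append] at h
    refine ih h.pathLine ?_ (by simp at hk ⊢; omega)
    intro h
    have := congrArg List.length h
    simp [ht] at this

/-- A cycle made of three arcs of equal size, with tails ending at the first vertices of the arcs,
such that any two tails can be joined through two arcs to form a path with at least `n` vertices. -/
structure ThreeTail (n : ℕ) (G : SimpleGraph V) (t₀ a₀ t₁ a₁ t₂ a₂ : List V) : Prop where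
  chain₀ : (t₀ ++ a₀ ++ a₁).IsChain G.Adj
  chain₁ : (t₁ ++ a₁ ++ a₂).IsChain G.Adj
  chain₂ : (t₂ ++ a₂ ++ a₀).IsChain G.Adj
  nodup : (t₀ ++ a₀ ++ ((t₁ ++ a₁) ++ (t₂ ++ a₂))).Nodup
  arc : a₀ ≠ []
  arc₁ : a₁.length = a₀.length
  arc₂ : a₂.length = a₀.length
  -- The 1 counts the first vertex of the third arc, where the path leaves the cycle.
  long₀₁ : n ≤ t₀.length + t₁.length + 2 * a₀.length + 1
  long₀₂ : n ≤ t₀.length + t₂.length + 2 * a₀.length + 1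
  long₁₂ : n ≤ t₁.length + t₂.length + 2 * a₀.length + 1

namespace ThreeTail
variable {t₀ a₀ t₁ a₁ t₂ a₂ : List V}

lemma rotate (h : ThreeTail n G t₀ a₀ t₁ a₁ t₂ a₂) : ThreeTail n G t₁ a₁ t₂ a₂ t₀ a₀ := by
  obtain ⟨c₀, c₁, c₂, nd, h₀, h₁, h₂, l₁, l₂, l₃⟩ := h
  refine ⟨c₁, c₂, c₀, ?_, ?_, by omega, by omega, by omega, by omega, by omega⟩
  · (refine nodup_of_count_le nd fun a => ?_; simp; omega)
  · rintro rfl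
    exact h₀ (List.length_eq_zero_iff.1 (by simpa using h₁.symm))

lemma path {u₂ : V} {b₂ : List V} (h : ThreeTail n G t₀ a₀ t₁ a₁ t₂ (u₂ :: b₂)) :
    (linkEdges (t₀ ++ a₀ ++ a₁ ++ u₂ :: t₂.reverse)).IsChain (pathLine n G).Adj := by
  obtain ⟨c₀, c₁, c₂, nd, h₀, h₁, -, -, l, -⟩ := h
  refine isChain_pathLine ?_ (nodup_of_count_le nd fun a => by simp [List.count_cons]; omega)
      (by simp at l ⊢; omega)
  have ha : a₁ ≠ [] := by
    rintro rfl
    exact h₀ (List.length_eq_zero_iff.1 (by simpa using h₁.symm))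
  have d₁ : (a₁ ++ [u₂]).IsChain G.Adj := c₁.infix ⟨t₁, b₂, by simp⟩
  have d₂ : (t₂ ++ [u₂]).reverse.IsChain G.Adj :=
    isChain_adj_reverse.2 (c₂.infix ⟨[], b₂ ++ a₀, by simp⟩)
  have d₃ := List.IsChain.append_overlap (l₁ := t₀ ++ a₀) c₀ d₁ ha
  have d₄ := List.IsChain.append_overlap (l₂ := [u₂]) (l₃ := t₂.reverse) d₃ (by simpa using d₂)
    (by simp)
  simpa using d₄

end ThreeTail

/-- The new cycle takes in p₁u₁ on its way past u₁: the path leaving along the second tail leads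
into this edge, and the path entering along that tail leads out of it. -/
lemma ThreeTail.chain_step {s₀ s₁ s₂ b₀ b₁ b₂ : List V} {p₀ p₁ p₂ u₀ u₁ u₂ : V}
    (h : ThreeTail n G (s₀ ++ [p₀]) (u₀ :: b₀) (s₁ ++ [p₁]) (u₁ :: b₁) (s₂ ++ [p₂]) (u₂ :: b₂)) :
    (linkEdges (s₀ ++ [p₀]) ++ linkEdges (p₀ :: u₀ :: (b₀ ++ [u₁])) ++
      linkEdges (p₁ :: u₁ :: (b₁ ++ [u₂]))).IsChain (_root_.pathLine n G).Adj := by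
  have P₀ := h.path
  have P₁ := h.rotate.path
  have P₂ := h.rotate.rotate.path
  rw [← linkEdges_append]
  have h₁ := linkEdges_append_chain (R := (_root_.pathLine n G).Adj) (l₁ := s₀ ++ [p₀])
    (m := u₀ :: b₀ ++ [u₁]) (l₂ := [p₁])
    (isChain_linkEdges_of_infix P₀ ⟨[], b₁ ++ u₂ :: (s₂ ++ [p₂]).reverse, by simp⟩)
    (isChain_linkEdges_of_infix P₂ ⟨s₂ ++ p₂ :: u₂ :: b₂, s₁.reverse, by simp⟩) (by simp)
  have e := linkEdges_append (s₀ ++ p₀ :: u₀ :: b₀) u₁ [p₁]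
  have h₂ : (linkEdges (p₁ :: u₁ :: (b₁ ++ [u₂]))).IsChain (_root_.pathLine n G).Adj :=
    isChain_linkEdges_of_infix P₁ ⟨s₁, b₂ ++ u₀ :: (s₀ ++ [p₀]).reverse, by simp⟩
  have h₃ := List.IsChain.append_overlap (l₁ := linkEdges (s₀ ++ p₀ :: u₀ :: (b₀ ++ [u₁])))
    (l₂ := [s(p₁, u₁)]) (l₃ := linkEdges (u₁ :: (b₁ ++ [u₂])))
    (by simp at e h₁; rwa [e, Sym2.eq_swap] at h₁) (by simpa using h₂) (by simp)
  simpa using h₃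

/-- Each tail gives one edge to its arc, so the arcs stay equal and the bounds are unchanged. -/
lemma ThreeTail.pathLine {s₀ s₁ s₂ b₀ b₁ b₂ : List V} {p₀ p₁ p₂ u₀ u₁ u₂ : V}
    (h : ThreeTail n G (s₀ ++ [p₀]) (u₀ :: b₀) (s₁ ++ [p₁]) (u₁ :: b₁) (s₂ ++ [p₂]) (u₂ :: b₂)) :
    ThreeTail n (pathLine n G)
      (linkEdges (s₀ ++ [p₀])) (linkEdges (p₀ :: u₀ :: (b₀ ++ [u₁])))
      (linkEdges (s₁ ++ [p₁])) (linkEdges (p₁ :: u₁ :: (b₁ ++ [u₂])))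
      (linkEdges (s₂ ++ [p₂])) (linkEdges (p₂ :: u₂ :: (b₂ ++ [u₀]))) := by
  refine ⟨h.chain_step, h.rotate.chain_step, h.rotate.rotate.chain_step, ?_, by simp, ?_, ?_, ?_,
    ?_, ?_⟩
  · have nd := h.nodup
    rw [← linkEdges_append, ← linkEdges_append, ← linkEdges_append]
    have d₀ := disjoint_linkEdges_concat (u := u₁) (w := u₂) nd (by simp) (by simp)
    have d₁ := disjoint_linkEdges_concat (u := u₂) (w := u₀) h.rotate.nodup (by simp) (by simp)
    have d₂ := disjoint_linkEdges_concat (u := u₀) (w := u₁) h.rotate.rotate.nodup (by simp)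
      (by simp)
    rw [List.nodup_append', List.nodup_append', List.disjoint_append_right]
    refine ⟨linkEdges_nodup ?_, ⟨linkEdges_nodup ?_, linkEdges_nodup ?_, ?_⟩, ?_, ?_⟩
    · (refine nodup_of_count_le nd fun a => ?_; simp [List.count_cons]; omega)
    · (refine nodup_of_count_le nd fun a => ?_; simp [List.count_cons]; omega)
    · (refine nodup_of_count_le nd fun a => ?_; simp [List.count_cons]; omega)
    · simpa using d₁
    · simpa using d₀
    · simpa using d₂.symm
  all_goals
    have h₁ := h.arc₁
    have h₂ := h.arc₂
    have h₃ := h.long₀₁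
    have h₄ := h.long₀₂
    have h₅ := h.long₁₂
    simp at h₁ h₂ h₃ h₄ h₅ ⊢
    omega

/-- The arc without a tail merges with the preceding one. Three nonempty arcs of size a have 3a ≥ 2a
+ 1 vertices, so the bounds for two tails hold. -/
lemma ThreeTail.hasLongPaths_of_nil (hn : 4 ≤ n) {t₀ a₀ a₁ t₂ a₂ : List V}
    (h : ThreeTail n G t₀ a₀ [] a₁ t₂ a₂) (ht : t₀ ≠ [] ∨ t₂ ≠ []) : HasLongPaths n G := by
  obtain ⟨c₀, c₁, c₂, nd, h₀, h₁, h₂, l₁, l₂, l₃⟩ := h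
  have hpos := List.length_pos_of_ne_nil h₀
  have ha₁ : a₁ ≠ [] := List.ne_nil_of_length_pos (by omega)
  have ha₂ : a₂ ≠ [] := List.ne_nil_of_length_pos (by omega)
  have d₀ : (t₀ ++ (a₀ ++ a₁) ++ a₂).IsChain G.Adj := by
    have := List.IsChain.append_overlap (l₁ := t₀ ++ a₀) c₀ (by simpa using c₁) ha₁
    simpa using this
  have d₁ : (t₂ ++ a₂ ++ (a₀ ++ a₁)).IsChain G.Adj := by
    have h' : (a₀ ++ a₁).IsChain G.Adj := c₀.infix ⟨t₀, [], by simp⟩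
    have := List.IsChain.append_overlap (l₁ := t₂ ++ a₂) c₂ h' h₀
    simpa using this
  simp at l₁ l₂ l₃
  rcases ht with ht | ht
  · refine TwoTail.hasLongPaths hn (t₀ := t₂) (a₀ := a₂) (t₁ := t₀) (a₁ := a₀ ++ a₁)
      ⟨d₁, d₀, ?_, ha₂, by simp [h₀], ?_, ?_, ?_⟩ ht
    · (refine nodup_of_count_le nd fun a => ?_; simp; omega)
    all_goals simp; omega
  · refine TwoTail.hasLongPaths hn (t₀ := t₀) (a₀ := a₀ ++ a₁) (t₁ := t₂) (a₁ := a₂)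
      ⟨d₀, d₁, ?_, by simp [h₀], ha₂, ?_, ?_, ?_⟩ ht
    · (refine nodup_of_count_le nd fun a => ?_; simp)
    all_goals simp; omega

/-- One step would absorb all tails at once and leave no pendant edge. So let the new cycle skip
p₁u₁, which becomes the pendant vertex; for arcs of size a it retains 3a + 2 ≥ 2a + 3 ≥ n vertices.
-/
lemma ThreeTail.hasLongPaths_of_singletons (hn : 4 ≤ n) {b₀ b₁ b₂ : List V}
    {p₀ p₁ p₂ u₀ u₁ u₂ : V} (h : ThreeTail n G [p₀] (u₀ :: b₀) [p₁] (u₁ :: b₁) [p₂] (u₂ :: b₂)) :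
    HasLongPaths n G := by
  apply HasLongPaths.of_pathLine
  have P₀ := h.path
  have hs := ThreeTail.pathLine (s₀ := []) (s₁ := []) (s₂ := []) h
  have h₁ := h.arc₁
  have h₂ := h.arc₂
  have h₃ := h.long₀₁
  -- x follows u₁ on the cycle; it is u₂ when the arc is a single vertex.
  obtain ⟨x, r, hr⟩ : ∃ x r, b₁ ++ [u₂] = x :: r := by cases b₁ <;> simp
  have hP : (linkEdges (p₀ :: u₀ :: (b₀ ++ [u₁, x]))).IsChain (_root_.pathLine n G).Adj := by
    refine isChain_linkEdges_of_infix P₀ ⟨[], r ++ [p₂], ?_⟩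
    have : b₁ ++ u₂ :: [p₂] = x :: r ++ [p₂] := by rw [← hr]; simp
    simp [this]
  have hlen : b₁.length = r.length := by
    have := congrArg List.length hr
    simpa using this
  have e : linkEdges (p₀ :: u₀ :: (b₀ ++ [u₁, x])) =
      linkEdges (p₀ :: u₀ :: (b₀ ++ [u₁])) ++ [s(u₁, x)] := by
    have := linkEdges_append (p₀ :: u₀ :: b₀) u₁ [x]
    simpa using this
  obtain ⟨c₀, c₁, c₂, nd, -⟩ := hs
  rw [hr] at c₀ c₁ nd
  simp only [List.nil_append, linkEdges_singleton] at c₀ c₁ c₂ nd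
  rw [e] at hP
  set A₀ := linkEdges (p₀ :: u₀ :: (b₀ ++ [u₁])) with hA₀
  set A₂ := linkEdges (p₂ :: u₂ :: (b₂ ++ [u₀])) with hA₂
  have hA₀' : A₀ ≠ [] := by simp [hA₀]
  have hA₂' : A₂ ≠ [] := by simp [hA₂]
  have hadj : (_root_.pathLine n G).Adj s(p₁, u₁) s(u₁, x) := by
    simp only [linkEdges_cons_cons, List.cons_append, List.isChain_cons_cons] at c₁
    exact c₁.1
  have hcyc := List.IsChain.append_overlap c₁ c₂ hA₂'
  simp only [linkEdges_cons_cons, List.cons_append, List.isChain_cons_cons] at hcyc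
  refine hasLongPaths_of_pendant hn (K := linkEdges (x :: r) ++ A₂ ++ A₀) (b := s(u₁, x))
    (c := s(p₁, u₁)) hcyc.2 ?_ ?_ ?_
  · have h₁ := List.IsChain.append_overlap (l₁ := linkEdges (x :: r) ++ A₂) (l₂ := A₀)
      hcyc.2.tail hP hA₀'
    have h₂ := List.IsChain.append_overlap (l₂ := [s(u₁, x)]) (l₃ := [s(p₁, u₁)]) h₁
      (by simpa using hadj.symm) (by simp)
    simpa using h₂
  · simp only [linkEdges_cons_cons, List.cons_append] at nd
    refine nodup_of_count_le nd fun a => ?_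
    simp [List.count_cons]; omega
  · simp [hA₀, hA₂] at h₁ h₂ h₃ ⊢
    omega

lemma ThreeTail.hasLongPaths (hn : 4 ≤ n) {t₀ a₀ t₁ a₁ t₂ a₂ : List V}
    (h : ThreeTail n G t₀ a₀ t₁ a₁ t₂ a₂) (ht : t₀ ≠ [] ∨ t₁ ≠ [] ∨ t₂ ≠ []) :
    HasLongPaths n G := by
  induction hk : t₀.length generalizing V with
  | zero =>
    obtain rfl := List.length_eq_zero_iff.1 hk
    exact h.rotate.rotate.hasLongPaths_of_nil hn (by tauto)
  | succ k ih =>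
    have ht₀ : t₀ ≠ [] := List.ne_nil_of_length_pos (by omega)
    by_cases ht₁ : t₁ = []
    · subst ht₁
      exact h.hasLongPaths_of_nil hn (by tauto)
    by_cases ht₂ : t₂ = []
    · subst ht₂
      exact h.rotate.hasLongPaths_of_nil hn (by tauto)
    have ha₀ := h.arc
    have ha₁ := h.rotate.arc
    have ha₂ := h.rotate.rotate.arc
    obtain ⟨s₀, p₀, rfl⟩ := (List.eq_nil_or_concat t₀).resolve_left ht₀
    obtain ⟨s₁, p₁, rfl⟩ := (List.eq_nil_or_concat t₁).resolve_left ht₁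
    obtain ⟨s₂, p₂, rfl⟩ := (List.eq_nil_or_concat t₂).resolve_left ht₂
    obtain ⟨u₀, b₀, rfl⟩ := List.exists_cons_of_ne_nil ha₀
    obtain ⟨u₁, b₁, rfl⟩ := List.exists_cons_of_ne_nil ha₁
    obtain ⟨u₂, b₂, rfl⟩ := List.exists_cons_of_ne_nil ha₂
    simp only [List.concat_eq_append] at h
    by_cases hs : s₀ = [] ∧ s₁ = [] ∧ s₂ = []
    · obtain ⟨rfl, rfl, rfl⟩ := hs
      exact ThreeTail.hasLongPaths_of_singletons hn h
    · apply HasLongPaths.of_pathLine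
      refine ih h.pathLine ?_ (by simpa using hk)
      have aux : ∀ (s : List V) (p : V), linkEdges (s ++ [p]) ≠ [] ↔ s ≠ [] := by
        intro s p
        rw [← List.length_pos_iff_ne_nil, ← List.length_pos_iff_ne_nil]
        simp
      rw [aux, aux, aux]
      tauto

end Tails

/-! ### Three long legs at a vertex -/

section Spider
variable {V : Type u} {G : SimpleGraph V} {n : ℕ}

/-- Three legs at `v`, each listed from `v` outwards, any two of which form with `v` a path with at
least `n` vertices. -/
lemma hasLongPaths_of_spider (hn : 4 ≤ n) {v : V} {t₀ t₁ t₂ : List V}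
    (c₀ : (v :: t₀).IsChain G.Adj) (c₁ : (v :: t₁).IsChain G.Adj) (c₂ : (v :: t₂).IsChain G.Adj)
    (nd : (v :: (t₀ ++ (t₁ ++ t₂))).Nodup) (h₀ : t₀ ≠ []) (h₁ : t₁ ≠ []) (h₂ : t₂ ≠ [])
    (l₁ : n ≤ t₀.length + t₁.length + 1) (l₂ : n ≤ t₀.length + t₂.length + 1)
    (l₃ : n ≤ t₁.length + t₂.length + 1) : HasLongPaths n G := by
  apply HasLongPaths.of_pathLine
  obtain ⟨p₀, t₀, rfl⟩ := List.exists_cons_of_ne_nil h₀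
  obtain ⟨p₁, t₁, rfl⟩ := List.exists_cons_of_ne_nil h₁
  obtain ⟨p₂, t₂, rfl⟩ := List.exists_cons_of_ne_nil h₂
  have key : ∀ (x y : V) (l m : List V), (v :: x :: l).IsChain G.Adj →
      (v :: y :: m).IsChain G.Adj → (v :: (x :: l ++ y :: m)).Nodup →
      n ≤ (x :: l).length + (y :: m).length + 1 →
      (linkEdges (l.reverse ++ [x]) ++ [s(x, v)] ++ [s(y, v)]).IsChain (pathLine n G).Adj := by
    intro x y l m hx hy hnd hlen
    have hP : ((v :: x :: l).reverse ++ y :: m).IsChain G.Adj := by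
      have := List.IsChain.append_overlap (l₁ := (x :: l).reverse) (l₂ := [v]) (l₃ := y :: m)
        (by have := isChain_adj_reverse.2 hx; simpa using this) hy (by simp)
      simpa using this
    have := isChain_pathLine (n := n) hP 
      (by refine nodup_of_count_le hnd fun a => ?_; simp [List.count_cons]; omega)
      (by simp at hlen ⊢; omega)
    have h₁ := isChain_linkEdges_of_infix (l := l.reverse ++ [x, v, y]) this ⟨[], m, by simp⟩
    rw [linkEdges_append] at h₁
    rw [Sym2.eq_swap (a := y)]
    simpa using h₁
  have e : ∀ (x : V) (l : List V), linkEdges (l.reverse ++ [x]) ++ [s(x, v)] =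
      linkEdges (l.reverse ++ [x, v]) := by
    intro x l
    have := linkEdges_append l.reverse x [v]
    simpa using this.symm
  have dj : ∀ {x y : V} {l m : List V}, (v :: (x :: l ++ y :: m)).Nodup →
      (linkEdges (l.reverse ++ [x, v])).Disjoint (linkEdges (m.reverse ++ [y, v])) := by
    intro x y l m hnd
    refine disjoint_linkEdges_of_eq v ?_ ?_
    · refine nodup_of_count_le hnd fun a => ?_
      simp [List.count_cons]; omega
    · have := (List.nodup_append'.1 (List.nodup_cons.1 hnd).2).2.2
      intro z hz hz'
      simp only [List.mem_append, List.mem_reverse, List.mem_cons, List.not_mem_nil,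
        or_false] at hz hz'
      by_contra hzv
      exact this (a := z) (by simp; tauto) (by simp; tauto)
  -- The three edges at v form a triangle with arcs of size one; the rest of each leg becomes a
  -- tail.
  refine ThreeTail.hasLongPaths hn (t₀ := linkEdges (t₀.reverse ++ [p₀])) (a₀ := [s(p₀, v)])
    (t₁ := linkEdges (t₁.reverse ++ [p₁])) (a₁ := [s(p₁, v)])
    (t₂ := linkEdges (t₂.reverse ++ [p₂])) (a₂ := [s(p₂, v)])
    ⟨key _ _ _ _ c₀ c₁ ?_ l₁, key _ _ _ _ c₁ c₂ ?_ l₃, key _ _ _ _ c₂ c₀ ?_ (by omega), ?_, by simp,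
      by simp, by simp, ?_, ?_, ?_⟩ ?_
  · (refine nodup_of_count_le nd fun a => ?_; simp [List.count_cons])
  · (refine nodup_of_count_le nd fun a => ?_; simp [List.count_cons]; omega)
  · (refine nodup_of_count_le nd fun a => ?_; simp [List.count_cons]; omega)
  · rw [e, e, e]
    rw [List.nodup_append', List.nodup_append', List.disjoint_append_right]
    refine ⟨linkEdges_nodup ?_, ⟨linkEdges_nodup ?_, linkEdges_nodup ?_, dj ?_⟩, dj ?_, dj ?_⟩ <;>
      (refine nodup_of_count_le nd fun a => ?_; simp [List.count_cons] <;> omega)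
  · simp at l₁ ⊢; omega
  · simp at l₂ ⊢; omega
  · simp at l₃ ⊢; omega
  -- Two legs consisting of one edge each would give n ≤ 3.
  · by_contra! hc
    obtain ⟨h₁, h₂, -⟩ := hc
    have h₁ := congrArg List.length h₁
    have h₂ := congrArg List.length h₂
    simp at h₁ h₂ l₁
    simp [h₁, h₂] at l₁
    omega

end Spider

/-! ### Branch depths and separation -/

section Branches
variable {V : Type*} {G : SimpleGraph V} {n : ℕ}

/-- The numbers of vertices of the paths that start at `u` and avoid `v`. -/
def branchLengths (G : SimpleGraph V) (v u : V) : Set ℕ :=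
  {k | ∃ l, (u :: l).IsChain G.Adj ∧ (u :: l).Nodup ∧ v ∉ u :: l ∧ (u :: l).length = k}

/-- The largest number of vertices of a path that starts at `u` and avoids `v`. -/
noncomputable def branchDepth (G : SimpleGraph V) (v u : V) : ℕ :=
  sSup (branchLengths G v u)

lemma bddAbove_branchLengths [Finite V] (v u : V) : BddAbove (branchLengths G v u) := by
  have := Fintype.ofFinite V
  refine ⟨Fintype.card V, ?_⟩
  rintro k ⟨l, -, h, -, rfl⟩
  exact h.length_le_card

lemma length_le_branchDepth [Finite V] {v u : V} {l : List V} (h₁ : (u :: l).IsChain G.Adj)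
    (h₂ : (u :: l).Nodup) (h₃ : v ∉ u :: l) : (u :: l).length ≤ branchDepth G v u :=
  le_csSup (bddAbove_branchLengths v u) ⟨l, h₁, h₂, h₃, rfl⟩

lemma exists_branch [Finite V] {v u : V} (h : v ≠ u) : ∃ l, (u :: l).IsChain G.Adj ∧
    (u :: l).Nodup ∧ v ∉ u :: l ∧ (u :: l).length = branchDepth G v u :=
  -- The one-vertex path makes the set nonempty, so its supremum is attained.
  Nat.sSup_mem (s := branchLengths G v u) ⟨1, [], by simp, by simp, by simpa using h, rfl⟩
    (bddAbove_branchLengths v u)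

lemma PathAdj.le_branchDepth [Finite V] {v u w : V} (h : PathAdj n G s(v, u) s(v, w)) :
    n ≤ branchDepth G v u + branchDepth G v w + 1 := by
  obtain ⟨l₁, a, b, c, l₂, h₁, h₂, h₃, he, hf⟩ := h
  have hnd : a ≠ b ∧ b ≠ c ∧ a ≠ c := by
    simp only [List.nodup_append, List.nodup_cons, List.mem_cons] at h₂
    tauto
  have hb : b = v ∧ a = u ∧ c = w := by
    rw [Sym2.eq_iff] at he hf
    grind
  obtain ⟨rfl, rfl, rfl⟩ := hb
  have k₁ : (a :: l₁.reverse).length ≤ branchDepth G b a := by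
    have e : a :: l₁.reverse = (l₁ ++ [a]).reverse := by simp
    refine length_le_branchDepth ?_ ?_ ?_
    · rw [e]
      exact isChain_adj_reverse.2 (h₁.infix ⟨[], b :: c :: l₂, by simp⟩)
    · refine nodup_of_count_le h₂ fun x => ?_
      simp [List.count_cons]
    · simp only [List.nodup_append, List.nodup_cons, List.mem_cons] at h₂
      simp only [List.mem_cons, List.mem_reverse]
      grind
  have k₂ : (c :: l₂).length ≤ branchDepth G b c := by
    refine length_le_branchDepth (h₁.infix ⟨l₁ ++ [a, b], [], by simp⟩) ?_ ?_
    · refine nodup_of_count_le h₂ fun x => ?_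
      simp [List.count_cons]; omega
    · simp only [List.nodup_append, List.nodup_cons, List.mem_cons] at h₂
      simp only [List.mem_cons]
      tauto
  simp at h₃ k₁ k₂
  omega

lemma exists_walk_of_mem {u x : V} {l : List V} (h : (u :: l).IsChain G.Adj) (hx : x ∈ u :: l) :
    ∃ p : G.Walk u x, ∀ y ∈ p.support, y ∈ u :: l := by
  induction l generalizing u with
  | nil =>
    obtain rfl : x = u := by simpa using hx
    exact ⟨Walk.nil, by simp⟩
  | cons w l ih =>
    rw [List.mem_cons] at hx
    rcases hx with rfl | hx
    · exact ⟨Walk.nil, by simp⟩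
    · rw [List.isChain_cons_cons] at h
      obtain ⟨p, hp⟩ := ih h.2 hx
      refine ⟨Walk.cons h.1 p, ?_⟩
      intro y hy
      rw [Walk.support_cons, List.mem_cons] at hy
      rcases hy with rfl | hy
      · simp
      · exact List.mem_cons_of_mem _ (hp y hy)

/-- Every walk between `u` and `w` passes through `v`. -/
def Separates (G : SimpleGraph V) (v u w : V) : Prop := ∀ p : G.Walk u w, v ∈ p.support

lemma Separates.disjoint {v u w : V} (h : Separates G v u w) {l m : List V}
    (hl : (u :: l).IsChain G.Adj) (hm : (w :: m).IsChain G.Adj) (hvl : v ∉ u :: l)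
    (hvm : v ∉ w :: m) : (u :: l).Disjoint (w :: m) := by
  intro x hx hx'
  obtain ⟨p, hp⟩ := exists_walk_of_mem hl hx
  obtain ⟨q, hq⟩ := exists_walk_of_mem hm hx'
  have := h (p.append q.reverse)
  rw [Walk.mem_support_append_iff, Walk.support_reverse, List.mem_reverse] at this
  rcases this with h | h
  · exact hvl (hp v h)
  · exact hvm (hq v h)

/-- Converse of `PathAdj.le_branchDepth`: longest branches at separated neighbours are disjoint and
join through v. -/
lemma pathAdj_of_separates [Finite V] {v u w : V} (h : Separates G v u w) (hu : G.Adj v u)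
    (hw : G.Adj v w) (hn : n ≤ branchDepth G v u + branchDepth G v w + 1) :
    PathAdj n G s(v, u) s(v, w) := by
  obtain ⟨l, hl, hnl, hvl, hll⟩ := exists_branch (G := G) hu.ne
  obtain ⟨m, hm, hnm, hvm, hlm⟩ := exists_branch (G := G) hw.ne
  have hd := h.disjoint hl hm hvl hvm
  refine ⟨l.reverse, u, v, w, m, ?_, ?_, ?_, Sym2.eq_swap, rfl⟩
  · have := isChain_adj_reverse.2 hl
    rw [List.isChain_append_cons_cons]
    exact ⟨by simpa using this, hu.symm, by simpa [hw] using hm⟩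
  · have : (v :: ((u :: l) ++ (w :: m))).Nodup := by
      rw [List.nodup_cons, List.nodup_append', List.mem_append]
      exact ⟨by tauto, hnl, hnm, hd⟩
    refine nodup_of_count_le this fun x => ?_
    simp [List.count_cons]; omega
  · simp at hll hlm ⊢; omega

lemma SimpleGraph.IsAcyclic.separates (h : G.IsAcyclic) {v u w : V} (hu : G.Adj v u)
    (hw : G.Adj v w) (huw : u ≠ w) : Separates G v u w := by
  classical
  intro p
  have hq : (Walk.cons hu.symm (Walk.cons hw Walk.nil)).IsPath := by
    simp [Walk.cons_isPath_iff, hw.ne, huw, hu.ne']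
  have := (h.subsingleton_path u w).elim p.toPath ⟨_, hq⟩
  apply p.support_toPath_subset_support
  rw [this]
  simp

lemma hasLongPaths_of_pathAdj_triple {V : Type u} [Finite V] {G : SimpleGraph V} (hn : 4 ≤ n)
    (hG : G.IsAcyclic) {v x y z : V} (hxy : PathAdj n G s(v, x) s(v, y))
    (hxz : PathAdj n G s(v, x) s(v, z)) (hyz : PathAdj n G s(v, y) s(v, z)) :
    HasLongPaths n G := by
  have hvx : G.Adj v x := hxy.left_mem
  have hvy : G.Adj v y := hxy.right_mem
  have hvz : G.Adj v z := hxz.right_mem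
  have nxy : x ≠ y := fun h => hxy.ne (by rw [h])
  have nxz : x ≠ z := fun h => hxz.ne (by rw [h])
  have nyz : y ≠ z := fun h => hyz.ne (by rw [h])
  obtain ⟨l₀, c₀, n₀, v₀, e₀⟩ := exists_branch (G := G) hvx.ne
  obtain ⟨l₁, c₁, n₁, v₁, e₁⟩ := exists_branch (G := G) hvy.ne
  obtain ⟨l₂, c₂, n₂, v₂, e₂⟩ := exists_branch (G := G) hvz.ne
  have d₀₁ := (hG.separates hvx hvy nxy).disjoint c₀ c₁ v₀ v₁
  have d₀₂ := (hG.separates hvx hvz nxz).disjoint c₀ c₂ v₀ v₂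
  have d₁₂ := (hG.separates hvy hvz nyz).disjoint c₁ c₂ v₁ v₂
  have k₀₁ := hxy.le_branchDepth
  have k₀₂ := hxz.le_branchDepth
  have k₁₂ := hyz.le_branchDepth
  refine hasLongPaths_of_spider hn (v := v) (t₀ := x :: l₀) (t₁ := y :: l₁) (t₂ := z :: l₂)
    (by simp [hvx, c₀]) (by simp [hvy, c₁]) (by simp [hvz, c₂]) ?_ (by simp) (by simp) (by simp)
    (by omega) (by omega) (by omega)
  rw [List.nodup_cons, List.nodup_append', List.nodup_append', List.disjoint_append_right,
    List.mem_append, List.mem_append]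
  exact ⟨by tauto, n₀, ⟨n₁, n₂, d₁₂⟩, d₀₁, d₀₂⟩

end Branches

/-! ### P_n-line graphs of forests -/

section Forest
variable {V : Type u} {G : SimpleGraph V} {n : ℕ}

lemma reachable_deleteEdges_of_walk (hn : 3 ≤ n) {e : Sym2 V} {x y : G.edgeSet}
    (r : (HLineGraph (pathGraph n) G).Walk x y) (hr : ∀ z ∈ r.support, z.1 ≠ e) {a b : V}
    (ha : a ∈ x.1) (hb : b ∈ y.1) : (G.deleteEdges {e}).Reachable a b := by
  have aux : ∀ (z : G.edgeSet), z.1 ≠ e → ∀ a b, a ∈ z.1 → b ∈ z.1 →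
      (G.deleteEdges {e}).Reachable a b := by
    rintro ⟨z, hz⟩ hze a b ha hb
    by_cases hab : a = b
    · rw [hab]
    · obtain rfl := (Sym2.mem_and_mem_iff hab).1 ⟨ha, hb⟩
      exact Adj.reachable (by simpa [hze] using hz)
  induction r generalizing a with
  | nil => exact aux _ (hr _ (by simp)) a b ha hb
  | @cons x x' y h r ih =>
    have hx : x.1 ≠ e := hr x (by simp)
    rw [hLineGraph_adj_iff hn] at h
    obtain ⟨l₁, c, d, f, l₂, -, -, -, h₁, h₂⟩ := h
    refine (aux x hx a d ha (by simp [h₁])).trans (ih (fun z hz => hr z (by simp [hz])) ?_ hb)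
    simp [h₂]

/-- In a forest, three consecutive vertices of a cycle of the line graph share an end. -/
lemma exists_common_vertex (hn : 3 ≤ n) (hG : G.IsAcyclic) {x y z : G.edgeSet}
    (hxy : (HLineGraph (pathGraph n) G).Adj x y) (hyz : (HLineGraph (pathGraph n) G).Adj y z)
    (r : (HLineGraph (pathGraph n) G).Walk z x) (hr : y ∉ r.support) :
    ∃ v a b c, x.1 = s(v, a) ∧ y.1 = s(v, b) ∧ z.1 = s(v, c) := by
  rw [hLineGraph_adj_iff hn] at hxy hyz
  obtain ⟨-, a, v, b, -, -, -, -, hx, hy⟩ := hxy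
  obtain ⟨-, b', w, c, -, -, -, -, hy', hz⟩ := hyz
  rw [hy, Sym2.eq_iff] at hy'
  rcases hy' with ⟨rfl, rfl⟩ | ⟨rfl, rfl⟩
  -- If y met x and z at different ends, the rest of the cycle would join these ends without y, but
  -- every edge of a forest is a bridge.
  · exfalso
    have hadj : G.Adj v b := by
      have := y.2
      rwa [hy] at this
    refine isAcyclic_iff_forall_adj_isBridge.1 hG hadj ?_
    rw [← hy]
    refine (reachable_deleteEdges_of_walk hn r ?_ (a := b) (b := v) (by simp [hz])
      (by simp [hx])).symm
    rintro t ht h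
    exact hr (Subtype.ext h ▸ ht)
  · exact ⟨v, a, b, c, by rw [hx, Sym2.eq_swap], hy, hz⟩

lemma isAcyclic_hLineGraph [Finite V] (hn : 4 ≤ n) (hG : G.IsAcyclic) (hl : ¬ HasLongPaths n G) :
    (HLineGraph (pathGraph n) G).IsAcyclic := by
  intro x₁ p hp
  match p, hp with
  | .nil, hp => exact hp.not_nil Walk.Nil.nil
  | .cons h .nil, hp => exact h.ne rfl
  | .cons h (.cons h' .nil), hp =>
    have := hp.three_le_length
    simp at this
  | .cons (v := x₂) h₁₂ (.cons (v := x₃) h₂₃ (.cons (v := x₄) h₃₄ q)), hp =>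
    have hnd := hp.support_nodup
    simp only [Walk.support_cons, List.tail_cons, List.nodup_cons, List.mem_cons, not_or] at hnd
    obtain ⟨⟨h23, h2q⟩, h3q, -⟩ := hnd
    obtain ⟨v, a, b, c, e₁, e₂, e₃⟩ := exists_common_vertex (by omega) hG h₁₂ h₂₃
      (Walk.cons h₃₄ q) (by simp [h23, h2q])
    obtain ⟨w, b', c', d, f₂, f₃, f₄⟩ := exists_common_vertex (by omega) hG h₂₃ h₃₄
      (q.concat h₁₂) (by simp [Walk.support_concat, h3q, Ne.symm h23])
    have hbc : b ≠ c := by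
      rintro rfl
      exact h23 (Subtype.ext (e₂.trans e₃.symm))
    -- The distinct edges x₂ and x₃ belong to both windows and have only one common end.
    have hvw : w = v ∧ b' = b ∧ c' = c := by
      rw [e₂, Sym2.eq_iff] at f₂
      rw [e₃, Sym2.eq_iff] at f₃
      grind
    obtain ⟨rfl, rfl, rfl⟩ := hvw
    rw [hLineGraph_adj_iff (by omega)] at h₁₂ h₂₃ h₃₄
    rw [e₁, e₂] at h₁₂
    rw [e₂, e₃] at h₂₃
    rw [e₃, f₄] at h₃₄
    have hx₁ : x₁ ∈ q.support := q.end_mem_support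
    have hx₄ : x₄ ∈ q.support := q.start_mem_support
    have hac : a ≠ c' := by
      rintro rfl
      exact h3q ((Subtype.ext (e₁.trans e₃.symm) : x₁ = x₃) ▸ hx₁)
    have hbd : b' ≠ d := by
      rintro rfl
      exact h2q ((Subtype.ext (e₂.trans f₄.symm) : x₂ = x₄) ▸ hx₄)
    have hva : G.Adj w a := h₁₂.left_mem
    have hvb : G.Adj w b' := h₁₂.right_mem
    have hvc : G.Adj w c' := h₂₃.right_mem
    have hvd : G.Adj w d := h₃₄.right_mem
    have k₁ := h₁₂.le_branchDepth
    have k₂ := h₂₃.le_branchDepth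
    have k₃ := h₃₄.le_branchDepth
    -- The depths of a, b' and those of c', d sum to at least n - 1 each, so the same holds for a,
    -- c' or for b', d. Either way three edges at w are pairwise path adjacent.
    rcases le_or_gt n (branchDepth G w a + branchDepth G w c' + 1) with h | h
    · exact hl (hasLongPaths_of_pathAdj_triple hn hG h₁₂
        (pathAdj_of_separates (hG.separates hva hvc hac) hva hvc h) h₂₃)
    · refine hl (hasLongPaths_of_pathAdj_triple hn hG h₂₃
        (pathAdj_of_separates (hG.separates hvb hvd hbd) hvb hvd ?_) h₃₄)
      omega

end Forest

/-! ### Counting by components; the dichotomy for forests -/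

section Counting
variable {V : Type u} {G : SimpleGraph V} {n : ℕ}

lemma card_edgeSet_eq_sum [Finite V] (G : SimpleGraph V) [Fintype G.ConnectedComponent] :
    Nat.card G.edgeSet = ∑ c : G.ConnectedComponent, Nat.card c.toSimpleGraph.edgeSet := by
  rw [← Nat.card_sigma]
  let f : (Σ c : G.ConnectedComponent, c.toSimpleGraph.edgeSet) → G.edgeSet :=
    fun x => ⟨x.2.1.map Subtype.val, by
      obtain ⟨c, ⟨e, he⟩⟩ := x
      induction e with | _ a b => exact he⟩
  refine (Nat.card_congr (Equiv.ofBijective f ⟨?_, ?_⟩)).symm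
  · rintro ⟨c, ⟨e, he⟩⟩ ⟨d, ⟨e', he'⟩⟩ h
    have h : e.map Subtype.val = e'.map Subtype.val := congrArg Subtype.val h
    have hcd : c = d := by
      induction e with | _ a b =>
      have : a.1 ∈ e'.map Subtype.val := by rw [← h]; simp
      obtain ⟨a', -, ha'⟩ := Sym2.mem_map.1 this
      have h₁ : G.connectedComponentMk a.1 = c := a.2
      have h₂ : G.connectedComponentMk a'.1 = d := a'.2
      rw [← h₁, ← h₂, ha']
    subst hcd
    obtain rfl := Sym2.map.injective Subtype.val_injective h
    rfl
  · rintro ⟨e, he⟩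
    induction e with | _ a b =>
    have hadj : G.Adj a b := he
    exact ⟨⟨G.connectedComponentMk a,
      ⟨s(⟨a, rfl⟩, ⟨b, (ConnectedComponent.sound hadj.reachable).symm⟩),
      hadj⟩⟩, rfl⟩

lemma card_eq_sum_card_component [Finite V] (G : SimpleGraph V) [Fintype G.ConnectedComponent] :
    Nat.card V = ∑ c : G.ConnectedComponent, Nat.card c := by
  rw [← Nat.card_sigma]
  exact Nat.card_congr (Equiv.sigmaFiberEquiv G.connectedComponentMk).symm

lemma card_edgeSet_lt_of_isAcyclic [Finite V] [Nonempty V] (hG : G.IsAcyclic) :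
    Nat.card G.edgeSet < Nat.card V := by
  have := Fintype.ofFinite G.ConnectedComponent
  rw [card_edgeSet_eq_sum, card_eq_sum_card_component G]
  refine Finset.sum_lt_sum_of_nonempty ?_ fun c _ => ?_
  · exact ⟨G.connectedComponentMk (Classical.arbitrary V), Finset.mem_univ _⟩
  · have := (isTree_iff_connected_and_card.1 (hG.isTree_connectedComponent c)).2
    omega

/-- The iterated `P_n`-line graphs of a forest terminate or grow without bound. -/
lemma terminates_or_isUnbounded [Finite V] (hn : 4 ≤ n) (hG : G.IsAcyclic) :
    HLTerminates (pathGraph n) G ∨ IsUnbounded n G := by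
  induction hk : Nat.card G.edgeSet using Nat.strong_induction_on generalizing V with
  | _ k ih =>
    by_cases hl : HasLongPaths n G
    · exact Or.inr (hl.isUnbounded (by omega))
    rcases isEmpty_or_nonempty G.edgeSet with hE | hE
    · exact Or.inl ⟨0, by
        have : G.edgeSet = ∅ := Set.isEmpty_coe_sort.1 hE
        exact edgeSet_eq_empty.1 this⟩
    · have hH := isAcyclic_hLineGraph hn hG hl
      -- The next graph is a nonempty forest whose vertices are the present edges, so it has fewer
      -- edges.
      rcases ih _ (hk ▸ card_edgeSet_lt_of_isAcyclic hH) hH rfl with h | h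
      · exact Or.inl (hlTerminates_of_hLineGraph h)
      · exact Or.inr h.of_hLineGraph

end Counting

/-! ### Unicyclic graphs -/

section Unicyclic
variable {V : Type u} {G : SimpleGraph V}

lemma card_edgeSet_deleteEdges [Finite V] {e : Sym2 V} (he : e ∈ G.edgeSet) :
    Nat.card (G.deleteEdges {e}).edgeSet + 1 = Nat.card G.edgeSet := by
  rw [Nat.card_coe_set_eq, Nat.card_coe_set_eq, edgeSet_deleteEdges]
  exact Set.ncard_sdiff_singleton_add_one he

lemma connected_deleteEdges_of_isCycle (hG : G.Connected) {v : V} {p : G.Walk v v}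
    (hp : p.IsCycle) {e : Sym2 V} (he : e ∈ p.edges) : (G.deleteEdges {e}).Connected := by
  induction e with | _ x y =>
  exact hG.connected_delete_edge_of_not_isBridge fun h => h.notMem_edges_of_isCycle hp he

lemma toSubgraph_eq_of_edges {u v : V} {p : G.Walk u u} {q : G.Walk v v} (hp : p.IsCycle)
    (hq : q.IsCycle) (h : ∀ e, e ∈ p.edges ↔ e ∈ q.edges) : p.toSubgraph = q.toSubgraph := by
  ext x y
  · rw [Walk.mem_verts_toSubgraph, Walk.mem_verts_toSubgraph,
      Walk.mem_support_iff_exists_mem_edges_of_not_nil hp.not_nil,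
      Walk.mem_support_iff_exists_mem_edges_of_not_nil hq.not_nil]
    simp [h]
  · rw [Walk.adj_toSubgraph_iff_mem_edges, Walk.adj_toSubgraph_iff_mem_edges, h]

/-- Deleting an edge of one cycle leaves a tree, so every other cycle uses that edge; hence all
cycles have the same edges. -/
lemma isUnicyclic_of_card [Finite V] (hG : G.Connected)
    (hc : Nat.card G.edgeSet = Nat.card V) : IsUnicyclic G := by
  refine ⟨hG, ?_⟩
  have hna : ¬ G.IsAcyclic := fun h => by
    have := (isTree_iff_connected_and_card.1 ⟨hG, h⟩).2
    omega
  have key : ∀ (u v : V) (p : G.Walk u u) (q : G.Walk v v), p.IsCycle → q.IsCycle →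
      ∀ e, e ∈ p.edges → e ∈ q.edges := by
    intro u v p q hp hq e he
    by_contra hne
    have h₁ := connected_deleteEdges_of_isCycle hG hp he
    have h₂ := card_edgeSet_deleteEdges (p.edges_subset_edgeSet he)
    have h₃ := isTree_iff_connected_and_card.2 ⟨h₁, by omega⟩
    refine h₃.isAcyclic _ (Walk.IsCycle.toDeleteEdges _ ({e} : Set (Sym2 V)) hq ?_)
    rintro f hf rfl
    exact hne hf
  unfold IsAcyclic at hna
  push Not at hna
  obtain ⟨v, p, hp⟩ := hna
  refine ⟨p.toSubgraph, ⟨v, p, hp, rfl⟩, ?_⟩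
  rintro C ⟨w, q, hq, rfl⟩
  exact toSubgraph_eq_of_edges hq hp fun e => ⟨key _ _ q p hq hp e, key _ _ p q hp hq e⟩

lemma IsUnicyclic.card_edgeSet [Finite V] (h : IsUnicyclic G) :
    Nat.card G.edgeSet = Nat.card V := by
  obtain ⟨hG, C, ⟨v, p, hp, rfl⟩, hC⟩ := h
  obtain ⟨e, he⟩ := p.edges.exists_mem_of_ne_nil (by simp [hp.not_nil])
  have h₁ := connected_deleteEdges_of_isCycle hG hp he
  have h₂ := card_edgeSet_deleteEdges (p.edges_subset_edgeSet he)
  have h₃ : (G.deleteEdges {e}).IsAcyclic := by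
    intro w q hq
    have hle : G.deleteEdges {e} ≤ G := G.deleteEdges_le {e}
    have h₄ := hC _ ⟨w, q.mapLe hle, hq.mapLe hle, rfl⟩
    induction e with | _ x y =>
    rw [← Walk.adj_toSubgraph_iff_mem_edges, ← h₄, Walk.adj_toSubgraph_mapLe,
      Walk.adj_toSubgraph_iff_mem_edges] at he
    have := q.edges_subset_edgeSet he
    simp at this
  have := (isTree_iff_connected_and_card.1 ⟨h₁, h₃⟩).2
  omega

lemma toSubgraph_eq_of_isUnicyclic (h : ∀ c : G.ConnectedComponent, IsUnicyclic c.toSimpleGraph)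
    {v : V} {p q : G.Walk v v} (hp : p.IsCycle) (hq : q.IsCycle) :
    p.toSubgraph = q.toSubgraph := by
  obtain ⟨-, C, -, hC⟩ := h (G.connectedComponentMk v)
  have hs : ∀ p : G.Walk v v, ∀ x ∈ p.support, x ∈ (G.connectedComponentMk v).supp := by
    intro p x hx
    obtain ⟨r, -⟩ := Walk.mem_support_iff_exists_append.1 hx
    exact ConnectedComponent.sound r.reachable.symm
  have key : ∀ p : G.Walk v v, p.IsCycle →
      p.toSubgraph = Subgraph.map (Embedding.induce (G := G) _).toHom C := by
    intro p hp
    have hc : (p.induce _ (hs p)).IsCycle := by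
      rw [← Walk.isCycle_map_iff_of_injective (f := (Embedding.induce (G := G) _).toHom)
        (Embedding.induce (G := G) _).injective, Walk.map_induce]
      exact hp
    have hC' : (p.induce _ (hs p)).toSubgraph = C := hC _ ⟨_, _, hc, rfl⟩
    rw [← hC']
    exact (congrArg Walk.toSubgraph (Walk.map_induce p (hs p))).symm.trans
      (Walk.toSubgraph_map _ _)
  rw [key p hp, key q hq]

/-- In a graph with unicyclic components, at most one pair of neighbours of `v` can be joined by a
walk avoiding `v`. -/
lemma eq_of_not_separates (h : ∀ c : G.ConnectedComponent, IsUnicyclic c.toSimpleGraph)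
    {v x y x' y' : V} (hx : G.Adj v x) (hy : G.Adj v y) (hxy : x ≠ y) (hs : ¬ Separates G v x y)
    (hx' : G.Adj v x') (hy' : G.Adj v y') (hxy' : x' ≠ y') (hs' : ¬ Separates G v x' y') :
    s(x, y) = s(x', y') := by
  classical
  -- A path from x to y avoiding v closes to a cycle whose edges at v are vx and vy; that cycle is
  -- unique.
  have key : ∀ {x y : V}, G.Adj v x → G.Adj v y → x ≠ y → ¬ Separates G v x y →
      ∃ p : G.Walk v v, p.IsCycle ∧ ∀ z, p.toSubgraph.Adj v z ↔ z = x ∨ z = y := by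
    intro x y hx hy hxy hs
    unfold Separates at hs
    push Not at hs
    obtain ⟨r, hr⟩ := hs
    have hv : v ∉ (r.toPath : G.Walk x y).support :=
      fun h => hr (r.support_toPath_subset_support h)
    have hve : ∀ z, s(v, z) ∉ (r.toPath : G.Walk x y).edges :=
      fun z h => hv (Walk.fst_mem_support_of_mem_edges _ h)
    refine ⟨Walk.cons hx ((r.toPath : G.Walk x y).concat hy.symm), ?_, fun z => ?_⟩
    · rw [Walk.cons_isCycle_iff, Walk.concat_isPath_iff]
      refine ⟨⟨r.toPath.2, hv⟩, ?_⟩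
      simp only [Walk.edges_concat, List.concat_eq_append, List.mem_append, List.mem_singleton,
        hve, false_or, Sym2.eq_iff]
      rintro (⟨h, -⟩ | ⟨-, h⟩)
      · exact hy.ne h
      · exact hxy h
    · rw [Walk.adj_toSubgraph_iff_mem_edges]
      simp only [Walk.edges_cons, Walk.edges_concat, List.concat_eq_append, List.mem_cons,
        List.mem_append, List.not_mem_nil, or_false, hve, false_or, Sym2.eq_iff]
      have := hx.ne
      have := hy.ne
      grind
  obtain ⟨p, hp, hp'⟩ := key hx hy hxy hs
  obtain ⟨q, hq, hq'⟩ := key hx' hy' hxy' hs'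
  rw [toSubgraph_eq_of_isUnicyclic h hp hq] at hp'
  have h₁ := (hq' x).1 ((hp' x).2 (Or.inl rfl))
  have h₂ := (hq' y).1 ((hp' y).2 (Or.inr rfl))
  rw [Sym2.eq_iff]
  grind

lemma exists_adj_of_isUnicyclic (h : ∀ c : G.ConnectedComponent, IsUnicyclic c.toSimpleGraph)
    (v : V) : ∃ w, G.Adj v w := by
  obtain ⟨hc, C, ⟨x, p, hp, -⟩, -⟩ := h (G.connectedComponentMk v)
  obtain ⟨r⟩ := hc.preconnected ⟨v, rfl⟩ x
  cases r with
  | nil =>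
    cases p with
    | nil => exact absurd Walk.Nil.nil hp.not_nil
    | cons h _ => exact ⟨_, h⟩
  | cons h _ => exact ⟨_, h⟩

end Unicyclic

/-! ### Local edge count at a vertex -/

section Transitions

/-- A graph without triangles and four-cycles, in which all but one of the pairs of total weight at
least `m` are adjacent and no other pairs are, has fewer edges than vertices. -/
lemma card_edgeSet_lt_of_threshold {D : Type*} [Finite D] [Nonempty D] {T : SimpleGraph D}
    {d : D → ℕ} {m : ℕ} (hT : ∀ a b, T.Adj a b → m ≤ d a + d b)
    (hbad : ∀ a b a' b', a ≠ b → ¬ T.Adj a b → m ≤ d a + d b → a' ≠ b' → ¬ T.Adj a' b' →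
      m ≤ d a' + d b' → s(a, b) = s(a', b'))
    (h₃ : ∀ a b c, T.Adj a b → T.Adj b c → ¬ T.Adj a c)
    (h₄ : ∀ a b c e, T.Adj a b → T.Adj b c → T.Adj c e → T.Adj e a → a = c ∨ b = e) :
    Nat.card T.edgeSet < Nat.card D := by
  obtain ⟨s, hs⟩ := Finite.exists_max d
  -- Charge each edge to an end other than the heaviest vertex s. If the edge avoids s, absence of
  -- triangles gives an end not adjacent to s.
  have hex : ∀ e : T.edgeSet, ∃ x y, e.1 = s(x, y) ∧ x ≠ s ∧ (y = s ∨ ¬ T.Adj s x) := by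
    rintro ⟨e, he⟩
    induction e with | _ x y =>
    have hadj : T.Adj x y := he
    by_cases hx : x = s
    · exact ⟨y, x, Sym2.eq_swap, fun h => hadj.ne (hx.trans h.symm), Or.inl hx⟩
    by_cases hy : y = s
    · exact ⟨x, y, rfl, hx, Or.inl hy⟩
    by_cases hsx : T.Adj s x
    · exact ⟨y, x, Sym2.eq_swap, hy, Or.inr (h₃ s x y hsx hadj)⟩
    · exact ⟨x, y, rfl, hx, Or.inr hsx⟩
  choose f g hfg hf hg using hex
  have hadj : ∀ e, T.Adj (f e) (g e) := fun e => by
    have := e.2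
    rwa [hfg e] at this
  have hle : ∀ e, m ≤ d s + d (f e) := fun e => by
    have h₁ := hT _ _ (hadj e)
    have h₂ := hs (g e)
    omega
  -- By maximality of s, both ends of e reach weight m together with s; if neither were adjacent to
  -- s, there would be two exceptional pairs.
  have hsg : ∀ e, ¬ T.Adj s (f e) → T.Adj s (g e) := by
    intro e he
    by_contra hn
    have hgs : g e ≠ s := by
      intro h
      exact he (h ▸ (hadj e).symm)
    have := hbad s (f e) s (g e) (hf e).symm he (hle e) hgs.symm hn (by
      have h₁ := hT _ _ (hadj e)
      have h₂ := hs (f e)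
      omega)
    rw [Sym2.eq_iff] at this
    rcases this with h | h
    · exact (hadj e).ne h.2
    · exact hf e h.2
  -- Two edges avoiding s and charged to the same vertex would close a four-cycle through s.
  have hinj : Function.Injective f := by
    intro e e' hee
    refine Subtype.ext ?_
    rw [hfg e, hfg e', hee]
    rcases hg e with h | h
    · rcases hg e' with h' | h'
      · rw [h, h']
      · exact absurd (h ▸ hee ▸ (hadj e).symm) h'
    · rcases hg e' with h' | h'
      · exact absurd (h' ▸ hee ▸ (hadj e').symm) h
      · have h₁ := hsg e h
        have h₂ := hsg e' h'
        rcases h₄ s (g e) (f e) (g e') h₁ (hadj e).symm (hee ▸ hadj e') h₂.symm with h₅ | h₅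
        · exact absurd h₅.symm (hf e)
        · rw [h₅]
  have := Fintype.ofFinite D
  have := Fintype.ofFinite T.edgeSet
  rw [Nat.card_eq_fintype_card, Nat.card_eq_fintype_card]
  refine Fintype.card_lt_of_injective_of_notMem f hinj (b := s) ?_
  rintro ⟨e, he⟩
  exact hf e he

lemma not_adj_of_four_lt_egirth {V : Type*} {G : SimpleGraph V} (h : 4 < G.egirth) {a b c : V}
    (hab : G.Adj a b) (hbc : G.Adj b c) : ¬ G.Adj a c := by
  intro hac
  have hp : (Walk.cons hab (Walk.cons hbc (Walk.cons hac.symm Walk.nil))).IsCycle := by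
    simp [Walk.cons_isCycle_iff, Walk.cons_isPath_iff, hab.ne, hbc.ne, hac.ne, hab.ne', hac.ne']
  have := h.trans_le (egirth_le_length hp)
  simp at this
  norm_cast at this

lemma eq_or_eq_of_four_lt_egirth {V : Type*} {G : SimpleGraph V} (h : 4 < G.egirth) {a b c d : V}
    (hab : G.Adj a b) (hbc : G.Adj b c) (hcd : G.Adj c d) (hda : G.Adj d a) : a = c ∨ b = d := by
  by_contra! hne
  have hp : (Walk.cons hab (Walk.cons hbc (Walk.cons hcd (Walk.cons hda Walk.nil)))).IsCycle := by
    simp [Walk.cons_isCycle_iff, Walk.cons_isPath_iff, hab.ne, hbc.ne, hcd.ne, hda.ne, hab.ne',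
      hda.ne', hne.1, hne.2, hne.1.symm]
  have := h.trans_le (egirth_le_length hp)
  simp at this

variable {V : Type u} {G : SimpleGraph V} {n : ℕ}

/-- The graph on the neighbours of `v` recording which edges at `v` are `n`-path adjacent. -/
def transitionGraph (n : ℕ) (G : SimpleGraph V) (v : V) : SimpleGraph (G.neighborSet v) where
  Adj a b := PathAdj n G s(v, a) s(v, b)
  symm := ⟨fun _ _ h => h.symm⟩
  loopless := ⟨fun _ h => h.ne rfl⟩

lemma card_edgeSet_transitionGraph_lt [Finite V] (hn : 3 ≤ n)
    (hgirth : 4 < (HLineGraph (pathGraph n) G).egirth)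
    (huni : ∀ c : G.ConnectedComponent, IsUnicyclic c.toSimpleGraph) (v : V) :
    Nat.card (transitionGraph n G v).edgeSet < Nat.card (G.neighborSet v) := by
  obtain ⟨w, hw⟩ := exists_adj_of_isUnicyclic huni v
  have : Nonempty (G.neighborSet v) := ⟨⟨w, hw⟩⟩
  have hadj : ∀ a b : G.neighborSet v, (transitionGraph n G v).Adj a b ↔
      (HLineGraph (pathGraph n) G).Adj ⟨s(v, a), a.2⟩ ⟨s(v, b), b.2⟩ :=
    fun a b => (hLineGraph_adj_iff hn (G := G) (e := ⟨s(v, a), a.2⟩) (f := ⟨s(v, b), b.2⟩)).symm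
  have hinj : ∀ a b : G.neighborSet v,
      (⟨s(v, a), a.2⟩ : G.edgeSet) = ⟨s(v, b), b.2⟩ → a = b := by
    intro a b h
    have := congrArg Subtype.val h
    exact Subtype.ext (Sym2.congr_right.1 this)
  have hsep : ∀ a b : G.neighborSet v, ¬ (transitionGraph n G v).Adj a b →
      n ≤ branchDepth G v a + 1 + branchDepth G v b → ¬ Separates G v a b :=
    fun a b hab hle hs => hab (pathAdj_of_separates hs a.2 b.2 (by omega))
  -- Adding one to each depth expresses the threshold n - 1 without truncated subtraction.
  refine card_edgeSet_lt_of_threshold (m := n + 1) (d := fun a => branchDepth G v a + 1)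
    ?_ ?_ ?_ ?_
  · intro a b h
    have := PathAdj.le_branchDepth h
    omega
  · intro a b a' b' hab h hle hab' h' hle'
    have := eq_of_not_separates huni a.2 b.2 (fun h => hab (Subtype.ext h))
      (hsep a b h (by omega)) a'.2 b'.2 (fun h => hab' (Subtype.ext h)) (hsep a' b' h' (by omega))
    exact Sym2.map.injective Subtype.val_injective (by simpa using this)
  · intro a b c hab hbc
    rw [hadj] at hab hbc ⊢
    exact not_adj_of_four_lt_egirth hgirth hab hbc
  · intro a b c e hab hbc hce hea
    rw [hadj] at hab hbc hce hea
    exact (eq_or_eq_of_four_lt_egirth hgirth hab hbc hce hea).imp (hinj _ _) (hinj _ _)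

lemma card_edgeSet_hLineGraph_le_sum [Fintype V] (hn : 3 ≤ n) :
    Nat.card (HLineGraph (pathGraph n) G).edgeSet ≤
      ∑ v, Nat.card (transitionGraph n G v).edgeSet := by
  rw [← Nat.card_sigma]
  let f : (Σ v, (transitionGraph n G v).edgeSet) → (HLineGraph (pathGraph n) G).edgeSet :=
    fun x => ⟨x.2.1.map fun a : G.neighborSet x.1 => (⟨s(x.1, a.1), a.2⟩ : G.edgeSet), by
      obtain ⟨v, ⟨e, he⟩⟩ := x
      induction e with | _ a b =>
      exact (hLineGraph_adj_iff hn).2 he⟩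
  refine Nat.card_le_card_of_surjective f ?_
  rintro ⟨e, he⟩
  induction e with | _ x y =>
  have h : PathAdj n G x y := (hLineGraph_adj_iff hn).1 he
  have h' := h
  obtain ⟨l₁, a, b, c, l₂, -, -, -, hx, hy⟩ := h
  rw [Sym2.eq_swap] at hx
  have hba : G.Adj b a := by
    have := x.2
    rwa [hx] at this
  have hbc : G.Adj b c := by
    have := y.2
    rwa [hy] at this
  rw [hx, hy] at h'
  refine ⟨⟨b, ⟨s(⟨a, hba⟩, ⟨c, hbc⟩), h'⟩⟩, Subtype.ext ?_⟩
  obtain ⟨x, hx₁⟩ := x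
  obtain ⟨y, hy₁⟩ := y
  subst hx hy
  rfl

/-- Summing the local bounds gives |E(HL(G))| + |V(G)| ≤ 2|E(G)|, and |V(G)| = |E(G)|. -/
lemma card_edgeSet_hLineGraph_le [Finite V] (hn : 3 ≤ n)
    (hgirth : 4 < (HLineGraph (pathGraph n) G).egirth)
    (huni : ∀ c : G.ConnectedComponent, IsUnicyclic c.toSimpleGraph) :
    Nat.card (HLineGraph (pathGraph n) G).edgeSet ≤ Nat.card G.edgeSet := by
  classical
  have := Fintype.ofFinite V
  have := Fintype.ofFinite G.ConnectedComponent
  have hcard : Nat.card G.edgeSet = Nat.card V := by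
    rw [card_edgeSet_eq_sum, card_eq_sum_card_component G]
    exact Finset.sum_congr rfl fun c _ => (huni c).card_edgeSet
  have hdeg : ∑ v, Nat.card (G.neighborSet v) = 2 * Nat.card G.edgeSet := by
    rw [Nat.card_eq_fintype_card, ← edgeFinset_card, ← G.sum_degrees_eq_twice_card_edges]
    exact Finset.sum_congr rfl fun v _ => by
      rw [Nat.card_eq_fintype_card, card_neighborSet_eq_degree]
  have hsum : ∑ v, (Nat.card (transitionGraph n G v).edgeSet + 1) ≤
      ∑ v, Nat.card (G.neighborSet v) :=
    Finset.sum_le_sum fun v _ => card_edgeSet_transitionGraph_lt hn hgirth huni v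
  rw [Finset.sum_add_distrib, hdeg] at hsum
  have h₁ := card_edgeSet_hLineGraph_le_sum (G := G) hn
  rw [Nat.card_eq_fintype_card (α := V)] at hcard
  simp at hsum
  simp at hcard h₁ ⊢
  omega

end Transitions

/-! ### Deleting a component of the P_n-line graph -/

section Minimality
variable {V : Type u} {G : SimpleGraph V} {n : ℕ}

/-- The subgraph obtained by deleting the edges that form a component of the `P_n`-line graph. -/
def deleteComponent (c : (HLineGraph (pathGraph n) G).ConnectedComponent) : G.Subgraph where
  verts := Set.univ
  Adj x y := ∃ h : G.Adj x y, (⟨s(x, y), h⟩ : G.edgeSet) ∉ c.supp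
  adj_sub h := h.1
  edge_vert _ := trivial
  symm := ⟨fun x y ⟨h, hc⟩ => ⟨h.symm, by
    rwa [show (⟨s(y, x), h.symm⟩ : G.edgeSet) = ⟨s(x, y), h⟩ from Subtype.ext Sym2.eq_swap]⟩⟩

variable {c : (HLineGraph (pathGraph n) G).ConnectedComponent}

lemma deleteComponent_ne_top : deleteComponent c ≠ ⊤ := by
  obtain ⟨⟨e, he⟩, hc⟩ := c.nonempty_supp
  induction e with | _ x y =>
  intro h
  have : (deleteComponent c).Adj x y := by
    rw [h]
    exact he
  exact this.2 hc

lemma map_val_mem_edgeSet {e : Sym2 (deleteComponent c).verts}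
    (he : e ∈ (deleteComponent c).coe.edgeSet) : e.map Subtype.val ∈ G.edgeSet := by
  induction e with | _ x y => exact he.1

lemma map_val_notMem_supp {e : Sym2 (deleteComponent c).verts}
    (he : e ∈ (deleteComponent c).coe.edgeSet) :
    (⟨e.map Subtype.val, map_val_mem_edgeSet he⟩ : G.edgeSet) ∉ c.supp := by
  induction e with | _ x y => exact he.2

/-- An edge outside a component of the `P_n`-line graph is only `n`-path adjacent to such edges. -/
lemma PathAdj.notMem_supp (hn : 3 ≤ n) {e f : Sym2 V} (h : PathAdj n G e f)
    (he : ∃ he : e ∈ G.edgeSet, (⟨e, he⟩ : G.edgeSet) ∉ c.supp) :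
    ∃ hf : f ∈ G.edgeSet, (⟨f, hf⟩ : G.edgeSet) ∉ c.supp := by
  obtain ⟨he, hc⟩ := he
  refine ⟨h.right_mem, fun hf => hc (c.mem_supp_of_adj_mem_supp hf ?_)⟩
  exact (hLineGraph_adj_iff hn).2 h.symm

/-- The edges of a path with at least n vertices lie in one component, so a path with an edge
outside c survives the deletion intact. -/
lemma pathAdj_deleteComponent (hn : 3 ≤ n) {e f : Sym2 (deleteComponent c).verts}
    (he : e ∈ (deleteComponent c).coe.edgeSet) :
    PathAdj n G (e.map Subtype.val) (f.map Subtype.val) ↔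
      PathAdj n (deleteComponent c).coe e f := by
  constructor
  · rintro ⟨l₁, x, y, z, l₂, h₁, h₂, h₃, hx, hy⟩
    have hall : ∀ g ∈ linkEdges (l₁ ++ x :: y :: z :: l₂),
        ∃ hg : g ∈ G.edgeSet, (⟨g, hg⟩ : G.edgeSet) ∉ c.supp := by
      refine (isChain_pathLine h₁ h₂ h₃).forall_mem_of_exists
        (fun g g' h hg => PathAdj.notMem_supp hn h hg) (x := s(x, y)) ?_ ?_
      · rw [linkEdges_append]; simp
      · rw [← hx]; exact ⟨_, map_val_notMem_supp he⟩
    let ι : V → (deleteComponent c).verts := fun x => ⟨x, trivial⟩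
    have hι : Function.Injective ι := fun a b h => congrArg Subtype.val h
    have hmap : ∀ g : Sym2 (deleteComponent c).verts, (g.map Subtype.val).map ι = g := by
      intro g
      rw [Sym2.map_map]
      exact congrFun Sym2.map_id' g
    have e' : l₁.map ι ++ ι x :: ι y :: ι z :: l₂.map ι = (l₁ ++ x :: y :: z :: l₂).map ι := by
      simp
    refine ⟨l₁.map ι, ι x, ι y, ι z, l₂.map ι, ?_, ?_, ?_, ?_, ?_⟩
    · rw [e', isChain_iff_linkEdges, linkEdges_map]
      intro g hg
      obtain ⟨g, hg', rfl⟩ := List.mem_map.1 hg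
      have := hall g hg'
      induction g with | _ a b => exact this
    · rw [e']; exact h₂.map hι
    · rw [e']; simpa using h₃
    · rw [← hmap e, hx]; rfl
    · rw [← hmap f, hy]; rfl
  · rintro ⟨l₁, x, y, z, l₂, h₁, h₂, h₃, rfl, rfl⟩
    have e' : l₁.map Subtype.val ++ x.1 :: y.1 :: z.1 :: l₂.map Subtype.val =
        (l₁ ++ x :: y :: z :: l₂).map Subtype.val := by simp
    refine ⟨l₁.map Subtype.val, x, y, z, l₂.map Subtype.val, ?_, ?_, ?_, rfl, rfl⟩
    · rw [e', List.isChain_map]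
      exact h₁.imp fun a b h => h.1
    · rw [e']; exact h₂.map Subtype.val_injective
    · rw [e']; simpa using h₃

/-- The `P_n`-line graph is the union of a component and the `P_n`-line graph of the graph with the
edges of that component deleted. -/
lemma splits_deleteComponent (hn : 3 ≤ n) : Splits c.toSimpleGraph
    (HLineGraph (pathGraph n) (deleteComponent c).coe) (HLineGraph (pathGraph n) G) := by
  let ψ : HLineGraph (pathGraph n) (deleteComponent c).coe ↪g HLineGraph (pathGraph n) G :=
    ⟨⟨fun e => ⟨e.1.map Subtype.val, map_val_mem_edgeSet e.2⟩, fun e f h => Subtype.ext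
      (Sym2.map.injective Subtype.val_injective (congrArg Subtype.val h))⟩, by
      intro e f
      rw [hLineGraph_adj_iff hn, hLineGraph_adj_iff hn]
      exact pathAdj_deleteComponent hn e.2⟩
  have hψ : ∀ e, e ∉ c.supp → e ∈ Set.range ψ := by
    rintro ⟨e, he⟩ hc
    induction e with | _ x y =>
    exact ⟨⟨s(⟨x, trivial⟩, ⟨y, trivial⟩), ⟨he, hc⟩⟩, rfl⟩
  refine ⟨Embedding.induce c.supp, ψ, ?_, ?_, ?_⟩
  · intro e f h
    exact ⟨⟨f, c.mem_supp_of_adj_mem_supp e.2 h⟩, rfl⟩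
  · intro e f h
    exact hψ f fun hf => map_val_notMem_supp e.2 (c.mem_supp_of_adj_mem_supp hf h.symm)
  · intro e
    by_cases he : e ∈ c.supp
    · exact Or.inl ⟨⟨e, he⟩, rfl⟩
    · exact Or.inr (hψ e he)

/-- No component of the `P_n`-line graph of a minimally convergent graph is a tree. -/
lemma IsMinimallyConvergent.not_isAcyclic [Finite V] (hn : 4 ≤ n)
    (hG : IsMinimallyConvergent n G) (c : (HLineGraph (pathGraph n) G).ConnectedComponent) :
    ¬ c.toSimpleGraph.IsAcyclic := by
  intro hc
  have hs := splits_deleteComponent (c := c) (by omega)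
  have hconv := hG.1.hLineGraph (by omega)
  rcases terminates_or_isUnbounded hn hc with ht | hu
  · exact hG.2 _ deleteComponent_ne_top (hs.hlConverges (by omega) ht hconv).of_hLineGraph
  · exact hconv.not_isUnbounded (by omega) (hs.isUnbounded (by omega) hu)

end Minimality

/-! ### Conclusion of the edge count -/

theorem theorem5 {V : Type*} [Finite V] (n : ℕ) (hn : 4 ≤ n) (G : SimpleGraph V)
    (hG : IsMinimallyConvergent n G)
    (hgirth : 4 < (HLineGraph (SimpleGraph.pathGraph n) G).egirth)
    (huni : ∀ c : G.ConnectedComponent, IsUnicyclic c.toSimpleGraph) :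
    ∀ c : (HLineGraph (SimpleGraph.pathGraph n) G).ConnectedComponent,
      IsUnicyclic c.toSimpleGraph := by
  have := Fintype.ofFinite (HLineGraph (pathGraph n) G).ConnectedComponent
  have hle := card_edgeSet_hLineGraph_le (by omega) hgirth huni
  rw [card_edgeSet_eq_sum, card_eq_sum_card_component (HLineGraph (pathGraph n) G)] at hle
  have hge : ∀ c : (HLineGraph (pathGraph n) G).ConnectedComponent,
      Nat.card c ≤ Nat.card c.toSimpleGraph.edgeSet := by
    intro c
    have h₁ := c.connected_toSimpleGraph.card_vert_le_card_edgeSet_add_one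
    by_contra! h₂
    exact hG.not_isAcyclic hn c
      (isTree_iff_connected_and_card.2 ⟨c.connected_toSimpleGraph, by omega⟩).isAcyclic
  -- The componentwise inequalities and the reverse inequality of the totals force equality in each
  -- component.
  have heq := (Finset.sum_eq_sum_iff_of_le fun c _ => hge c).1
    (le_antisymm (Finset.sum_le_sum fun c _ => hge c) hle)
  exact fun c => isUnicyclic_of_card c.connected_toSimpleGraph (heq c (Finset.mem_univ c)).symm
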